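/- Let $(X^{(i)},Y^{(i)})_{i\ge1}$ be i.i.d. with values in $\mathbb{R}^d\times\{1,\dots,K\}$, fix a class $y$ with $\mathbb{P}(Y=y)>0$, and let $n_y=|\{i\le n:Y^{(i)}=y\}|$. Assume that the class-conditional marginal distribution functions $F_{j|y}$ are continuous, and that the conditional law of $(F_{1|y}(X_1),\dots,F_{d|y}(X_d))$ given $Y=y$ has a density $c$ on $[0,1]^d$ (the copula density) which is Lipschitz (hence bounded) and lies in the Sobolev class $W_2^r([0,1]^d)$ for some real $r>d/2$. For a fully connected ReLU network $g_\theta:\mathbb{R}^d\to\mathbb{R}$ put $NN(u;\theta)=\log(1+e^{g_\theta(u)})$ and $$\tilde c(u;\theta)=\frac{NN(u;\theta)}{\int_{[0,1]^d}NN(v;\theta)\,dv},\qquad D(\theta)=\sum_{i=1}^d\int_0^1\Big(\int_{[0,1]^{d-1}}\tilde c(u;\theta)\,du_{-i}-1\Big)^2du_i .$$ Let $\Theta_n$ be the set of networks with at most $L_n$ hidden layers, at most $S_n$ parameters, all parameters bounded by $B_n$ in absolute value, and $g_\theta$ Lipschitz on $[0,1]^d$ with a constant $\Lambda$ not depending on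 $n$; here $L_n=O(\log n)$, $S_n\asymp n^{d/(2r+d)}$ up to powers of $\log n$, and $B_n$ is at most polynomial in $n$. Assume the approximation capacity $$\inf_{\theta\in\Theta_n}\ \sup_{u\in[0,1]^d}|NN(u;\theta)-c(u)|=O\big(n^{-r/(2r+d)}\big).$$ Let $\widehat F_{j|y}$, with values in $[0,1]$, be the empirical distribution function of the $j$th coordinate in class $y$ at sample size $n$, possibly smoothed, where the smoothing changes it by $O_p(n_y^{-1/2})$ uniformly on $\mathbb{R}$; put $\hat u^{(i)}=(\widehat F_{1|y}(X^{(i)}_1),\dots,\widehat F_{d|y}(X^{(i)}_d))$. Let $\lambda_n\to\infty$, and let $\hat\theta_n$ be any sequence such that, for all large $n$, almost surely, $\hat\theta_n$ maximizes $$Q_n(\theta)=\frac1{n_y}\sum_{i\le n:\,Y^{(i)}=y}\log\tilde c(\hat u^{(i)};\theta)-\lambda_nD(\theta)$$ over $\Theta_n$. Then $\tilde c(\cdot;\hat\theta_n)$ is positive on $[0,1]^d$ and integrates to $1$ there, and $$D(\hat\theta_n)\xrightarrow{\;p\;}0 ,\qquad\text{and moreover}\qquad D(\hat\theta_n)=o_p\big(n^{-r/(2r+d)}\big).$$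 So the fitted neural density is asymptotically a valid copula density, with a non-uniformity of its marginals that is of smaller order than the rate $n^{-r/(2r+d)}$. -/

import Mathlib

open MeasureTheory ProbabilityTheory Filter Topology Set

open scoped NNReal ENNReal

namespace DeepCopula

noncomputable section

/-- The unit cube `[0,1]^d`. -/
def cube (d : ℕ) : Set (Fin d → ℝ) := Icc 0 1

/-! ### Networks -/

/-- Fully connected feed-forward networks with `k` real inputs, ReLU hidden layers and one real
affine output. `layer A b N` applies `x ↦ max (A x + b) 0` coordinatewise and then `N`. -/
inductive ReLUNet : ℕ → Type
  | out {k : ℕ} (w : Fin k → ℝ) (b : ℝ) : ReLUNet k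
  | layer {k m : ℕ} (A : Matrix (Fin m) (Fin k) ℝ) (b : Fin m → ℝ) (N : ReLUNet m) : ReLUNet k

namespace ReLUNet

/-- The real-valued function computed by the network (before the positive output map). -/
def eval : {k : ℕ} → ReLUNet k → (Fin k → ℝ) → ℝ
  | _, out w b, x => (∑ j, w j * x j) + b
  | _, layer A b N, x => N.eval (fun i => max ((∑ j, A i j * x j) + b i) 0)

/-- Depth: the number of hidden layers. -/
def depth : {k : ℕ} → ReLUNet k → ℕ
  | _, out _ _ => 0
  | _, layer _ _ N => N.depth + 1

/-- Size: the total number of parameters (weights and biases). -/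
def size : {k : ℕ} → ReLUNet k → ℕ
  | k, out _ _ => k + 1
  | _, @layer k m _ _ N => m * k + m + N.size

/-- All parameters are bounded by `B` in absolute value. -/
def ParamsBoundedBy (B : ℝ) : {k : ℕ} → ReLUNet k → Prop
  | _, out w b => (∀ j, |w j| ≤ B) ∧ |b| ≤ B
  | _, layer A b N => (∀ i j, |A i j| ≤ B) ∧ (∀ i, |b i| ≤ B) ∧ N.ParamsBoundedBy B

end ReLUNet

/-- `softplus t = log (1 + e^t)`. -/
def softplus (t : ℝ) : ℝ := Real.log (1 + Real.exp t)

/-- The positive network: ReLU hidden layers and softplus output. -/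
def positiveNet {d : ℕ} (θ : ReLUNet d) (u : Fin d → ℝ) : ℝ := softplus (θ.eval u)

/-- The normalized positive network `NN(u;θ) / ∫_{[0,1]^d} NN(v;θ) dv`. -/
def neuralDensity {d : ℕ} (θ : ReLUNet d) (u : Fin d → ℝ) : ℝ :=
  positiveNet θ u / ∫ v in cube d, positiveNet θ v

/-- The network class: at most `L` hidden layers, at most `S` parameters, parameters bounded by `B`,
and network function in the Lipschitz ball of radius `Λ` on the cube. -/
def sieve (d L S : ℕ) (B : ℝ) (Λ : ℝ≥0) : Set (ReLUNet d) :=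
  {θ | θ.depth ≤ L ∧ θ.size ≤ S ∧ θ.ParamsBoundedBy B ∧ LipschitzOnWith Λ θ.eval (cube d)}

/-! ### Marginal defect -/

/-- The point of `ℝ^d` whose `i`th coordinate is `t` and whose other coordinates are `v`. -/
def insertCoord {d : ℕ} (i : Fin d) (t : ℝ) (v : {j : Fin d // j ≠ i} → ℝ) : Fin d → ℝ :=
  fun j => if h : j = i then t else v ⟨j, h⟩

/-- The `i`th univariate marginal `t ↦ ∫_{[0,1]^{d-1}} g(u) du_{-i}` at `u_i = t`. -/
def marginal {d : ℕ} (g : (Fin d → ℝ) → ℝ) (i : Fin d) (t : ℝ) : ℝ :=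
  ∫ v in Icc (0 : {j : Fin d // j ≠ i} → ℝ) 1, g (insertCoord i t v)

/-- `D(g) = ∑_i ∫_0^1 (∫ g(u) du_{-i} - 1)^2 du_i`. -/
def marginalDefect {d : ℕ} (g : (Fin d → ℝ) → ℝ) : ℝ :=
  ∑ i, ∫ t in (0 : ℝ)..1, (marginal g i t - 1) ^ 2

/-! ### Data -/

section data

variable {Ω : Type*} [MeasurableSpace Ω] {d K : ℕ}

/-- The marginal distribution function `F_{j|y}` of the `j`th coordinate of `X` given `Y = y`. -/
def classCDF (P : Measure Ω) (X : Ω → Fin d → ℝ) (Y : Ω → Fin K) (y : Fin K) (j : Fin d)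
    (x : ℝ) : ℝ :=
  cdf ((cond P (Y ⁻¹' {y})).map (fun ω => X ω j)) x

/-- `c` is the copula density of `X` given `Y = y`: the density on `[0,1]^d` of the conditional law
of the probability integral transforms `(F_{1|y}(X_1), …, F_{d|y}(X_d))`. -/
def IsCopulaDensity (P : Measure Ω) (X : Ω → Fin d → ℝ) (Y : Ω → Fin K) (y : Fin K)
    (c : (Fin d → ℝ) → ℝ) : Prop :=
  (∀ u ∈ cube d, 0 ≤ c u) ∧
    (cond P (Y ⁻¹' {y})).map (fun ω j => classCDF P X Y y j (X ω j)) =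
      (volume.restrict (cube d)).withDensity (fun u => ENNReal.ofReal (c u))

/-- `c` belongs to the Sobolev class `W_2^r([0,1]^d)` (real order `r`): it is the restriction to the
cube of an element of the Sobolev space of order `r` in `L²(ℝ^d)`. -/
def MemSobolevCube (r : ℝ) (c : (Fin d → ℝ) → ℝ) : Prop :=
  ∃ f : Lp ℂ 2 (volume : Measure (EuclideanSpace ℝ (Fin d))),
    TemperedDistribution.MemSobolev r 2 (Lp.toTemperedDistribution f) ∧
      ∀ᵐ x : EuclideanSpace ℝ (Fin d), (x : Fin d → ℝ) ∈ cube d → f x = (c x : ℂ)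

/-- The indices among the first `n` with label `y`. -/
def classIndices (Y : ℕ → Ω → Fin K) (y : Fin K) (n : ℕ) (ω : Ω) : Finset ℕ :=
  (Finset.range n).filter (fun i => Y i ω = y)

/-- The class count `n_y`. -/
def classCount (Y : ℕ → Ω → Fin K) (y : Fin K) (n : ℕ) (ω : Ω) : ℕ :=
  (classIndices Y y n ω).card

/-- The class-conditional empirical distribution function of the `j`th coordinate. -/
def empiricalCDF (X : ℕ → Ω → Fin d → ℝ) (Y : ℕ → Ω → Fin K) (y : Fin K) (n : ℕ) (ω : Ω)
    (j : Fin d) (x : ℝ) : ℝ :=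
  (((classIndices Y y n ω).filter (fun i => X i ω j ≤ x)).card : ℝ) / classCount Y y n ω

/-- `Fhat` takes values in `[0,1]` and is the class-conditional empirical distribution function up
to a smoothing whose effect is `O_p(n_y^{-1/2})` uniformly on the line (the empirical distribution
function itself is the case of no smoothing). -/
def IsSmoothedEmpiricalCDF (P : Measure Ω) (X : ℕ → Ω → Fin d → ℝ) (Y : ℕ → Ω → Fin K)
    (y : Fin K) (Fhat : ℕ → Ω → Fin d → ℝ → ℝ) : Prop :=
  (∀ n ω j x, Fhat n ω j x ∈ Icc (0 : ℝ) 1) ∧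
    ∀ ε : ℝ, 0 < ε → ∃ M : ℝ, ∀ᶠ n : ℕ in atTop,
      P {ω | ∃ j x, M < √(classCount Y y n ω : ℝ) *
        |Fhat n ω j x - empiricalCDF X Y y n ω j x|} ≤ ENNReal.ofReal ε

/-- The normalized log-likelihood of the pseudo-observations `û⁽ⁱ⁾ = Fhat (X⁽ⁱ⁾)` of class `y`. -/
def logLikelihood (X : ℕ → Ω → Fin d → ℝ) (Y : ℕ → Ω → Fin K) (y : Fin K)
    (Fhat : ℕ → Ω → Fin d → ℝ → ℝ) (n : ℕ) (ω : Ω) (θ : ReLUNet d) : ℝ :=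
  (1 / (classCount Y y n ω : ℝ)) *
    ∑ i ∈ classIndices Y y n ω, Real.log (neuralDensity θ (fun j => Fhat n ω j (X i ω j)))

/-- The penalized objective `ℓ_n(θ) - λ_n D(θ)`. -/
def penalizedObjective (X : ℕ → Ω → Fin d → ℝ) (Y : ℕ → Ω → Fin K) (y : Fin K)
    (Fhat : ℕ → Ω → Fin d → ℝ → ℝ) (lam : ℕ → ℝ) (n : ℕ) (ω : Ω) (θ : ReLUNet d) : ℝ :=
  logLikelihood X Y y Fhat n ω θ - lam n * marginalDefect (neuralDensity θ)

end data

end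

end DeepCopula

namespace DeepCopula

/-! ### The softplus function -/

lemma softplus_pos (t : ℝ) : 0 < softplus t :=
  Real.log_pos (by linarith [Real.exp_pos t])

lemma continuous_softplus : Continuous softplus := by
  unfold softplus
  exact Continuous.log (by fun_prop) (fun t => by positivity)

lemma softplus_mono : Monotone softplus := fun a b h =>
  Real.log_le_log (by positivity) (by gcongr)

/-- The logarithm of softplus is `1`-Lipschitz. -/
lemma softplus_le_exp_mul {a b e : ℝ} (h : |a - b| ≤ e) :
    softplus a ≤ Real.exp e * softplus b := by
  have he : 0 ≤ e := (abs_nonneg _).trans h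
  have hab : a ≤ b + e := by linarith [(abs_le.1 h).2]
  refine (softplus_mono hab).trans ?_
  have hB := one_add_mul_self_le_rpow_one_add (s := Real.exp b) (p := Real.exp e)
    (by linarith [Real.exp_pos b]) (Real.one_le_exp he)
  unfold softplus
  rw [← Real.log_rpow (by positivity), Real.exp_add, mul_comm]
  exact Real.log_le_log (by positivity) hB

/-! ### The unit cube -/

lemma measurableSet_cube (d : ℕ) : MeasurableSet (cube d) := measurableSet_Icc

lemma isCompact_cube (d : ℕ) : IsCompact (cube d) := isCompact_Icc

lemma volume_cube (d : ℕ) : volume (cube d) = 1 := by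
  simp [cube, Real.volume_Icc_pi]

instance isProbabilityMeasure_cube (d : ℕ) :
    IsProbabilityMeasure (volume.restrict (cube d)) :=
  ⟨by rw [Measure.restrict_apply_univ, volume_cube]⟩

lemma dist_le_one_of_mem_cube {d : ℕ} {u v : Fin d → ℝ} (hu : u ∈ cube d) (hv : v ∈ cube d) :
    dist u v ≤ 1 := by
  refine (dist_pi_le_iff zero_le_one).2 fun j => ?_
  have h1 := hu.1 j; have h2 := hu.2 j; have h3 := hv.1 j; have h4 := hv.2 j
  simp only [Pi.zero_apply, Pi.one_apply] at h1 h2 h3 h4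
  rw [Real.dist_eq, abs_le]
  constructor <;> linarith

/-! ### The neural density -/

lemma ReLUNet.continuous_eval : ∀ {k : ℕ} (θ : ReLUNet k), Continuous θ.eval
  | _, .out w b => by
    have : Continuous fun x : Fin _ → ℝ => (∑ j, w j * x j) + b := by fun_prop
    exact this
  | _, .layer A b N => by
    have := N.continuous_eval
    have h : Continuous fun (x : Fin _ → ℝ) i => max ((∑ j, A i j * x j) + b i) 0 := by fun_prop
    exact this.comp h

section density

variable {d : ℕ}

lemma continuous_positiveNet (θ : ReLUNet d) : Continuous (positiveNet θ) :=
  continuous_softplus.comp θ.continuous_eval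

lemma positiveNet_pos (θ : ReLUNet d) (u : Fin d → ℝ) : 0 < positiveNet θ u := softplus_pos _

lemma integrableOn_positiveNet (θ : ReLUNet d) : IntegrableOn (positiveNet θ) (cube d) :=
  (continuous_positiveNet θ).continuousOn.integrableOn_compact (isCompact_cube d)

lemma integral_positiveNet_pos (θ : ReLUNet d) : 0 < ∫ v in cube d, positiveNet θ v := by
  rw [integral_pos_iff_support_of_nonneg (fun v => (positiveNet_pos θ v).le)
    (integrableOn_positiveNet θ)]
  have : Function.support (positiveNet θ) = univ :=
    eq_univ_of_forall fun v => (positiveNet_pos θ v).ne'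
  rw [this, measure_univ]
  exact one_pos

lemma neuralDensity_pos (θ : ReLUNet d) (u : Fin d → ℝ) : 0 < neuralDensity θ u :=
  div_pos (positiveNet_pos θ u) (integral_positiveNet_pos θ)

lemma continuous_neuralDensity (θ : ReLUNet d) : Continuous (neuralDensity θ) :=
  (continuous_positiveNet θ).div_const _

lemma integrableOn_neuralDensity (θ : ReLUNet d) : IntegrableOn (neuralDensity θ) (cube d) :=
  (continuous_neuralDensity θ).continuousOn.integrableOn_compact (isCompact_cube d)

lemma integral_neuralDensity (θ : ReLUNet d) : ∫ u in cube d, neuralDensity θ u = 1 := by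
  unfold neuralDensity
  rw [integral_div, div_self (integral_positiveNet_pos θ).ne']

/-- Networks that are uniformly close on the cube have close neural log-densities. -/
lemma neuralDensity_le_exp_mul {θ θ' : ReLUNet d} {e : ℝ}
    (h : ∀ u ∈ cube d, |θ.eval u - θ'.eval u| ≤ e) {u : Fin d → ℝ} (hu : u ∈ cube d) :
    neuralDensity θ u ≤ Real.exp (2 * e) * neuralDensity θ' u := by
  have hI : ∫ v in cube d, positiveNet θ' v ≤ Real.exp e * ∫ v in cube d, positiveNet θ v := by
    rw [← integral_const_mul]
    refine setIntegral_mono_on (integrableOn_positiveNet θ')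
      ((integrableOn_positiveNet θ).const_mul _) (measurableSet_cube d) fun v hv => ?_
    exact softplus_le_exp_mul (by rw [abs_sub_comm]; exact h v hv)
  have hN : positiveNet θ u ≤ Real.exp e * positiveNet θ' u := softplus_le_exp_mul (h u hu)
  have h1 := integral_positiveNet_pos θ
  have h2 := integral_positiveNet_pos θ'
  unfold neuralDensity
  rw [← mul_div_assoc, div_le_div_iff₀ h1 h2, two_mul, Real.exp_add]
  calc positiveNet θ u * ∫ v in cube d, positiveNet θ' v
      ≤ (Real.exp e * positiveNet θ' u) * (Real.exp e * ∫ v in cube d, positiveNet θ v) :=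
        mul_le_mul hN hI h2.le (mul_nonneg (Real.exp_pos _).le (positiveNet_pos _ _).le)
    _ = _ := by ring

lemma log_neuralDensity_le {θ θ' : ReLUNet d} {e : ℝ}
    (h : ∀ u ∈ cube d, |θ.eval u - θ'.eval u| ≤ e) {u : Fin d → ℝ} (hu : u ∈ cube d) :
    Real.log (neuralDensity θ u) ≤ Real.log (neuralDensity θ' u) + 2 * e := by
  have := Real.log_le_log (neuralDensity_pos θ u) (neuralDensity_le_exp_mul h hu)
  rw [Real.log_mul (Real.exp_pos _).ne' (neuralDensity_pos _ _).ne', Real.log_exp] at this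
  linarith

lemma positiveNet_le_exp_mul {θ : ReLUNet d} {Λ : ℝ≥0} (hθ : LipschitzOnWith Λ θ.eval (cube d))
    {u v : Fin d → ℝ} (hu : u ∈ cube d) (hv : v ∈ cube d) :
    positiveNet θ u ≤ Real.exp (Λ * dist u v) * positiveNet θ v :=
  softplus_le_exp_mul (by rw [← Real.dist_eq]; exact hθ.dist_le_mul u hu v hv)

lemma log_neuralDensity_sub_le {θ : ReLUNet d} {Λ : ℝ≥0}
    (hθ : LipschitzOnWith Λ θ.eval (cube d))
    {u v : Fin d → ℝ} (hu : u ∈ cube d) (hv : v ∈ cube d) :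
    Real.log (neuralDensity θ u) - Real.log (neuralDensity θ v) ≤ Λ * dist u v := by
  have h := Real.log_le_log (positiveNet_pos θ u) (positiveNet_le_exp_mul hθ hu hv)
  rw [Real.log_mul (Real.exp_pos _).ne' (positiveNet_pos _ _).ne', Real.log_exp] at h
  unfold neuralDensity
  rw [Real.log_div (positiveNet_pos _ _).ne' (integral_positiveNet_pos θ).ne',
    Real.log_div (positiveNet_pos _ _).ne' (integral_positiveNet_pos θ).ne']
  linarith

lemma exp_neg_le_neuralDensity {θ : ReLUNet d} {Λ : ℝ≥0}
    (hθ : LipschitzOnWith Λ θ.eval (cube d)) {u : Fin d → ℝ} (hu : u ∈ cube d) :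
    Real.exp (-Λ) ≤ neuralDensity θ u := by
  have hI : ∫ v in cube d, positiveNet θ v ≤ Real.exp Λ * positiveNet θ u := by
    calc ∫ v in cube d, positiveNet θ v
        ≤ ∫ _v in cube d, Real.exp Λ * positiveNet θ u := by
          refine setIntegral_mono_on (integrableOn_positiveNet θ) (integrable_const _)
            (measurableSet_cube d) fun v hv => ?_
          refine (positiveNet_le_exp_mul hθ hv hu).trans ?_
          have := positiveNet_pos θ u
          gcongr
          exact mul_le_of_le_one_right Λ.2 (dist_le_one_of_mem_cube hv hu)
      _ = _ := by simp
  unfold neuralDensity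
  rw [le_div_iff₀ (integral_positiveNet_pos θ)]
  calc Real.exp (-Λ) * ∫ v in cube d, positiveNet θ v
      ≤ Real.exp (-Λ) * (Real.exp Λ * positiveNet θ u) := by gcongr
    _ = _ := by rw [← mul_assoc, ← Real.exp_add]; simp

lemma neuralDensity_le_exp {θ : ReLUNet d} {Λ : ℝ≥0}
    (hθ : LipschitzOnWith Λ θ.eval (cube d)) {u : Fin d → ℝ} (hu : u ∈ cube d) :
    neuralDensity θ u ≤ Real.exp Λ := by
  have hI : positiveNet θ u ≤ Real.exp Λ * ∫ v in cube d, positiveNet θ v := by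
    rw [← integral_const_mul]
    calc positiveNet θ u = ∫ _v in cube d, positiveNet θ u := by simp
      _ ≤ _ := by
          refine setIntegral_mono_on (integrable_const _)
            ((integrableOn_positiveNet θ).const_mul _) (measurableSet_cube d) fun v hv => ?_
          refine (positiveNet_le_exp_mul hθ hu hv).trans ?_
          have := positiveNet_pos θ v
          gcongr
          exact mul_le_of_le_one_right Λ.2 (dist_le_one_of_mem_cube hu hv)
  unfold neuralDensity
  rwa [div_le_iff₀ (integral_positiveNet_pos θ)]

end density

/-! ### Finite nets of network classes -/

namespace ReLUNet

/-- Apply a function to every parameter of a network. -/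
def mapParams (f : ℝ → ℝ) : {k : ℕ} → ReLUNet k → ReLUNet k
  | _, out w b => out (fun j => f (w j)) (f b)
  | _, layer A b N => layer (fun i j => f (A i j)) (fun i => f (b i)) (N.mapParams f)

/-- All parameters belong to `T`. -/
def ParamsIn (T : Set ℝ) : {k : ℕ} → ReLUNet k → Prop
  | _, out w b => (∀ j, w j ∈ T) ∧ b ∈ T
  | _, layer A b N => (∀ i j, A i j ∈ T) ∧ (∀ i, b i ∈ T) ∧ N.ParamsIn T

lemma depth_mapParams (f : ℝ → ℝ) : ∀ {k : ℕ} (θ : ReLUNet k), (θ.mapParams f).depth = θ.depth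
  | _, out _ _ => rfl
  | _, layer _ _ N => by simp only [mapParams, depth, N.depth_mapParams f]

lemma size_mapParams (f : ℝ → ℝ) : ∀ {k : ℕ} (θ : ReLUNet k), (θ.mapParams f).size = θ.size
  | _, out _ _ => rfl
  | _, layer _ _ N => by simp only [mapParams, size, N.size_mapParams f]

lemma ParamsBoundedBy.mono {B B' : ℝ} (h : B ≤ B') :
    ∀ {k : ℕ} {θ : ReLUNet k}, θ.ParamsBoundedBy B → θ.ParamsBoundedBy B'
  | _, out _ _, hθ => ⟨fun j => (hθ.1 j).trans h, hθ.2.trans h⟩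
  | _, layer _ _ _, hθ =>
    ⟨fun i j => (hθ.1 i j).trans h, fun i => (hθ.2.1 i).trans h, mono h hθ.2.2⟩

lemma paramsIn_mapParams {f : ℝ → ℝ} {B : ℝ} {T : Set ℝ} (hf : ∀ x, |x| ≤ B → f x ∈ T) :
    ∀ {k : ℕ} {θ : ReLUNet k}, θ.ParamsBoundedBy B → (θ.mapParams f).ParamsIn T
  | _, out _ _, hθ => ⟨fun j => hf _ (hθ.1 j), hf _ hθ.2⟩
  | _, layer _ _ _, hθ =>
    ⟨fun i j => hf _ (hθ.1 i j), fun i => hf _ (hθ.2.1 i), paramsIn_mapParams hf hθ.2.2⟩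

/-- Networks of bounded size and depth with parameters in a finite set form a finite set. -/
lemma exists_finset_paramsIn (T : Finset ℝ) (hT : 1 ≤ T.card) (L : ℕ) :
    ∀ k S : ℕ, ∃ G : Finset (ReLUNet k), G.card ≤ (S + 2) ^ L * T.card ^ S ∧
      ∀ θ : ReLUNet k, θ.depth ≤ L → θ.size ≤ S → θ.ParamsIn T → θ ∈ G := by
  classical
  have hout : ∀ k S : ℕ, ∃ G : Finset (ReLUNet k), G.card ≤ T.card ^ S ∧
      ∀ w b, k + 1 ≤ S → (out w b : ReLUNet k).ParamsIn T → out w b ∈ G := by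
    intro k S
    by_cases hk : k + 1 ≤ S
    · refine ⟨((Fintype.piFinset fun _ : Fin k => T) ×ˢ T).image fun p => out p.1 p.2, ?_, ?_⟩
      · refine Finset.card_image_le.trans ?_
        rw [Finset.card_product, Fintype.card_piFinset_const, ← pow_succ]
        exact Nat.pow_le_pow_right hT hk
      · intro w b _ h
        exact Finset.mem_image.2 ⟨(w, b), by simpa [ParamsIn] using h, rfl⟩
    · exact ⟨∅, by simp, fun w b h => absurd h hk⟩
  induction L with
  | zero =>
    intro k S
    obtain ⟨G, hG, hmem⟩ := hout k S
    refine ⟨G, by simpa using hG, fun θ hd hs hp => ?_⟩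
    cases θ with
    | out w b => exact hmem w b hs hp
    | layer A b N => simp [depth] at hd
  | succ L ih =>
    intro k S
    obtain ⟨G₀, hG₀, hmem₀⟩ := hout k S
    have hlay : ∀ m : ℕ, ∃ G : Finset (ReLUNet k), G.card ≤ (S + 2) ^ L * T.card ^ S ∧
        ∀ (A : Matrix (Fin m) (Fin k) ℝ) b N, depth (layer A b N) ≤ L + 1 →
          size (layer A b N) ≤ S → ParamsIn T (layer A b N) → layer A b N ∈ G := by
      intro m
      by_cases hm : m * k + m ≤ S
      · obtain ⟨G, hG, hmem⟩ := ih m (S - (m * k + m))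
        refine ⟨((Fintype.piFinset fun _ : Fin m => Fintype.piFinset fun _ : Fin k => T) ×ˢ
          (Fintype.piFinset fun _ : Fin m => T) ×ˢ G).image fun p => layer p.1 p.2.1 p.2.2, ?_, ?_⟩
        · refine Finset.card_image_le.trans ?_
          rw [Finset.card_product, Finset.card_product, Fintype.card_piFinset_const,
            Fintype.card_piFinset_const, Fintype.card_piFinset_const]
          calc (T.card ^ k) ^ m * (T.card ^ m * G.card)
              ≤ (T.card ^ k) ^ m * (T.card ^ m *
                ((S + 2) ^ L * T.card ^ (S - (m * k + m)))) := by
                gcongr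
                refine hG.trans ?_
                gcongr
                omega
            _ = (S + 2) ^ L * (T.card ^ (m * k + m) * T.card ^ (S - (m * k + m))) := by
                rw [pow_add, mul_comm m k, pow_mul]; ring
            _ = _ := by rw [← pow_add, Nat.add_sub_cancel' hm]
        · intro A b N hd hs hp
          simp only [depth, size, ParamsIn] at hd hs hp
          refine Finset.mem_image.2 ⟨(A, b, N), ?_, rfl⟩
          exact Finset.mem_product.2
            ⟨Fintype.mem_piFinset.2 fun i => Fintype.mem_piFinset.2 (hp.1 i), Finset.mem_product.2 ⟨Fintype.mem_piFinset.2 hp.2.1,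
              hmem N (by omega) (by omega) hp.2.2⟩⟩
      · refine ⟨∅, by simp, fun A b N _ hs => ?_⟩
        simp only [size] at hs
        omega
    choose G hG hmem using hlay
    refine ⟨G₀ ∪ (Finset.range (S + 1)).biUnion G, ?_, ?_⟩
    · calc _ ≤ G₀.card + ((Finset.range (S + 1)).biUnion G).card := Finset.card_union_le _ _
        _ ≤ T.card ^ S + (S + 1) * ((S + 2) ^ L * T.card ^ S) := by
          gcongr
          refine (Finset.card_biUnion_le_card_mul _ _ _ fun m _ => hG m).trans ?_
          simp
        _ ≤ (S + 2) ^ L * T.card ^ S + (S + 1) * ((S + 2) ^ L * T.card ^ S) := by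
          gcongr
          exact Nat.le_mul_of_pos_left _ (by positivity)
        _ = _ := by ring
    · intro θ hd hs hp
      cases θ with
      | out w b => exact Finset.mem_union_left _ (hmem₀ w b hs hp)
      | @layer _ m A b N =>
        refine Finset.mem_union_right _ (Finset.mem_biUnion.2 ⟨m, ?_, hmem m A b N hd hs hp⟩)
        simp only [size] at hs
        rw [Finset.mem_range]
        have : 0 ≤ m * k := Nat.zero_le _
        omega

lemma abs_affine_le {k : ℕ} {a x : Fin k → ℝ} {b W R : ℝ} (hk : (k : ℝ) ≤ W) (hW : 1 ≤ W)
    (hR : 1 ≤ R) (ha : ∀ j, |a j| ≤ W) (hb : |b| ≤ W) (hx : ∀ j, |x j| ≤ R) :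
    |(∑ j, a j * x j) + b| ≤ 2 * W ^ 2 * R := by
  have h1 : |∑ j, a j * x j| ≤ k * (W * R) := by
    refine (Finset.abs_sum_le_sum_abs _ _).trans ?_
    refine (Finset.sum_le_card_nsmul _ _ (W * R) fun j _ => ?_).trans (by simp)
    rw [abs_mul]
    exact mul_le_mul (ha j) (hx j) (abs_nonneg _) (by linarith)
  have h2 : (k : ℝ) * (W * R) ≤ W * (W * R) := by gcongr
  have h3 : W ≤ W * (W * R) := le_mul_of_one_le_right (by linarith)
    (one_le_mul_of_one_le_of_one_le hW hR)
  calc _ ≤ |∑ j, a j * x j| + |b| := abs_add_le _ _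
    _ ≤ W * (W * R) + W * (W * R) := by linarith
    _ = _ := by ring

lemma abs_affine_sub_le {k : ℕ} {a a' x x' : Fin k → ℝ} {b b' W R e η : ℝ} (hk : (k : ℝ) ≤ W)
    (hW : 1 ≤ W) (hR : 1 ≤ R) (he : 0 ≤ e) (hη : 0 ≤ η) (hη1 : η ≤ 1) (ha : ∀ j, |a j| ≤ W)
    (ha' : ∀ j, |a j - a' j| ≤ η) (hb : |b - b'| ≤ η) (hx : ∀ j, |x j| ≤ R)
    (hx' : ∀ j, |x j - x' j| ≤ e) :
    |((∑ j, a j * x j) + b) - ((∑ j, a' j * x' j) + b')| ≤ 2 * W ^ 2 * (e + η * R) := by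
  have h1 : |∑ j, (a j * x j - a' j * x' j)| ≤ k * (η * R + 2 * W * e) := by
    refine (Finset.abs_sum_le_sum_abs _ _).trans ?_
    refine (Finset.sum_le_card_nsmul _ _ (η * R + 2 * W * e) fun j _ => ?_).trans
      (by simp [mul_add])
    have : a j * x j - a' j * x' j = (a j - a' j) * x j + a' j * (x j - x' j) := by ring
    rw [this]
    refine (abs_add_le _ _).trans ?_
    rw [abs_mul, abs_mul]
    have h2 : |a' j| ≤ 2 * W := by
      have := abs_sub_abs_le_abs_sub (a' j) (a j)
      rw [abs_sub_comm] at this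
      linarith [ha j, ha' j]
    exact add_le_add (mul_le_mul (ha' j) (hx j) (abs_nonneg _) hη)
      (mul_le_mul h2 (hx' j) (abs_nonneg _) (by linarith))
  have h2 : (k : ℝ) * (η * R + 2 * W * e) ≤ W * (η * R + 2 * W * e) := by gcongr
  have h3 : η ≤ W ^ 2 * (η * R) := by
    have : 1 ≤ W ^ 2 * R := one_le_mul_of_one_le_of_one_le (one_le_pow₀ hW) hR
    nlinarith
  have h4 : W * (η * R) ≤ W ^ 2 * (η * R) := by
    gcongr
    nlinarith
  rw [add_sub_add_comm, ← Finset.sum_sub_distrib]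
  calc _ ≤ |∑ j, (a j * x j - a' j * x' j)| + |b - b'| := abs_add_le _ _
    _ ≤ W * (η * R + 2 * W * e) + W ^ 2 * (η * R) := by linarith
    _ ≤ _ := by nlinarith

/-- Perturbation bound for networks under a perturbation of the parameters and of the input. -/
lemma abs_eval_sub_eval_mapParams_le {f : ℝ → ℝ} {W η : ℝ} {S : ℕ} (hS : (S : ℝ) ≤ W)
    (hW : 1 ≤ W) (hη : 0 ≤ η) (hη1 : η ≤ 1) (hf : ∀ x, |x - f x| ≤ η) :
    ∀ {k : ℕ} (θ : ReLUNet k) {R e : ℝ} {x x' : Fin k → ℝ}, θ.size ≤ S → θ.ParamsBoundedBy W →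
      1 ≤ R → 0 ≤ e → (∀ j, |x j| ≤ R) → (∀ j, |x j - x' j| ≤ e) →
      |θ.eval x - (θ.mapParams f).eval x'| ≤
        (2 * W ^ 2) ^ (θ.depth + 1) * (e + (θ.depth + 1) * η * R)
  | k, out w b, R, e, x, x', hs, hp, hR, he, hx, hx' => by
    have hk : (k : ℝ) ≤ W := by
      refine le_trans ?_ hS
      simp only [size] at hs
      exact_mod_cast (by omega : k ≤ S)
    simpa [eval, mapParams, depth] using abs_affine_sub_le hk hW hR he hη hη1 hp.1
      (fun j => hf (w j)) (hf b) hx hx'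
  | k, @layer _ m A b N, R, e, x, x', hs, hp, hR, he, hx, hx' => by
    have hk : ∀ i : Fin m, (k : ℝ) ≤ W := by
      intro i
      refine le_trans ?_ hS
      simp only [size] at hs
      have : k ≤ m * k := Nat.le_mul_of_pos_left _ i.pos
      exact_mod_cast (by omega : k ≤ S)
    have hQ : 1 ≤ 2 * W ^ 2 := by nlinarith
    have key := abs_eval_sub_eval_mapParams_le hS hW hη hη1 hf N
      (R := 2 * W ^ 2 * R) (e := 2 * W ^ 2 * (e + η * R))
      (x := fun i => max ((∑ j, A i j * x j) + b i) 0)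
      (x' := fun i => max ((∑ j, f (A i j) * x' j) + f (b i)) 0)
      (by simp only [size] at hs; omega) hp.2.2 (one_le_mul_of_one_le_of_one_le hQ hR)
      (by positivity)
      (fun i => by
        have h := abs_affine_le (hk i) hW hR (hp.1 i) (hp.2.1 i) hx
        refine le_trans ?_ h
        rw [abs_of_nonneg (le_max_right _ _)]
        exact max_le (le_abs_self _) (abs_nonneg _))
      (fun i => (abs_max_sub_max_le_abs _ _ _).trans
        (abs_affine_sub_le (hk i) hW hR he hη hη1 (hp.1 i) (fun j => hf _) (hf _) hx hx'))
    refine key.trans (le_of_eq ?_)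
    simp only [depth]
    push_cast
    ring

/-- A finite uniform net, on the unit cube, of the networks of bounded depth, size and
parameters. -/
lemma exists_finset_approx (k L S w q : ℕ) (hSw : S ≤ w) (hw : 1 ≤ w) (hq : 1 ≤ q) :
    ∃ G : Finset (ReLUNet k), G.card ≤ (S + 2) ^ L * (5 * q * w) ^ S ∧
      ∀ θ : ReLUNet k, θ.depth ≤ L → θ.size ≤ S → θ.ParamsBoundedBy w → ∃ θ' ∈ G,
        ∀ x ∈ cube k, |θ.eval x - θ'.eval x| ≤ (2 * (w : ℝ) ^ 2) ^ (L + 1) * (L + 1) / q := by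
  classical
  have hq0 : (0 : ℝ) < q := by exact_mod_cast hq
  have hq1 : (1 : ℝ) ≤ q := by exact_mod_cast hq
  have hw1 : (1 : ℝ) ≤ w := by exact_mod_cast hw
  set T : Finset ℝ := (Finset.Icc (-((q * w + 1 : ℕ) : ℤ)) ((q * w + 1 : ℕ) : ℤ)).image
    fun z : ℤ => (z : ℝ) / q with hT
  set f : ℝ → ℝ := fun x => (⌊q * x⌋ : ℝ) / q with hf
  have hfT : ∀ x, |x| ≤ (w : ℝ) → f x ∈ T := by
    intro x hx
    refine Finset.mem_image.2 ⟨⌊q * x⌋, ?_, rfl⟩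
    obtain ⟨h1, h2⟩ := abs_le.1 hx
    rw [Finset.mem_Icc]
    constructor
    · rw [Int.le_floor]
      push_cast
      nlinarith
    · rw [Int.floor_le_iff]
      push_cast
      nlinarith
  have hfη : ∀ x, |x - f x| ≤ 1 / (q : ℝ) := by
    intro x
    have h1 := Int.floor_le ((q : ℝ) * x)
    have h2 := Int.lt_floor_add_one ((q : ℝ) * x)
    have : x - f x = (q * x - ⌊(q : ℝ) * x⌋) / q := by
      simp only [hf]; field_simp
    rw [this, abs_of_nonneg (div_nonneg (by linarith) hq0.le)]
    gcongr
    linarith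
  have hTne : 1 ≤ T.card := Finset.card_pos.2 ⟨f 0, hfT 0 (by simp)⟩
  have hTc : T.card ≤ 5 * q * w := by
    refine Finset.card_image_le.trans ?_
    rw [Int.card_Icc]
    have : 1 ≤ q * w := Nat.mul_pos hq hw
    have h5 : 5 * q * w = 5 * (q * w) := by ring
    rw [h5]
    omega
  obtain ⟨G, hG, hmem⟩ := exists_finset_paramsIn T hTne L k S
  refine ⟨G, hG.trans (by gcongr), fun θ hd hs hp => ⟨θ.mapParams f, hmem _ ?_ ?_ ?_, ?_⟩⟩
  · rwa [depth_mapParams]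
  · rwa [size_mapParams]
  · exact paramsIn_mapParams hfT hp
  · intro x hx
    have hx1 : ∀ j, |x j| ≤ 1 := fun j => by
      have h1 := hx.1 j
      have h2 := hx.2 j
      simp only [Pi.zero_apply, Pi.one_apply] at h1 h2
      rwa [abs_of_nonneg h1]
    have hη1 : 1 / (q : ℝ) ≤ 1 := by rw [div_le_one hq0]; exact hq1
    have := abs_eval_sub_eval_mapParams_le (S := S) (by exact_mod_cast hSw) hw1
      (by positivity) hη1 hfη θ hs hp le_rfl le_rfl hx1 (x' := x) (fun j => by simp)
    refine this.trans ?_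
    have hQ : 1 ≤ 2 * (w : ℝ) ^ 2 := by nlinarith
    calc (2 * (w : ℝ) ^ 2) ^ (θ.depth + 1) * (0 + (θ.depth + 1) * (1 / (q : ℝ)) * 1)
        ≤ (2 * (w : ℝ) ^ 2) ^ (L + 1) * (0 + (L + 1) * (1 / (q : ℝ)) * 1) := by
          gcongr
      _ = _ := by ring

end ReLUNet

/-! ### The probability integral transform -/

lemma measure_cdf_le_of_mem_Ico {μ : Measure ℝ} [IsProbabilityMeasure μ] (hF : Continuous (cdf μ))
    {t : ℝ} (ht : t ∈ Ico (0 : ℝ) 1) : μ {x | cdf μ x ≤ t} = ENNReal.ofReal t := by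
  rcases eq_empty_or_nonempty {x | cdf μ x ≤ t} with he | hne
  · have h0 : t ≤ 0 := by
      refine ge_of_tendsto (tendsto_cdf_atBot μ) (Eventually.of_forall fun x => ?_)
      by_contra h
      exact (he ▸ (show x ∈ {x | cdf μ x ≤ t} from (not_le.1 h).le) : x ∈ (∅ : Set ℝ))
    rw [he, measure_empty, ENNReal.ofReal_of_nonpos h0]
  · obtain ⟨z, hz⟩ := ((tendsto_cdf_atTop μ).eventually (lt_mem_nhds ht.2)).exists
    have hbdd : BddAbove {x | cdf μ x ≤ t} :=
      ⟨z, fun x hx => le_of_not_gt fun h => absurd ((monotone_cdf μ h.le).trans hx) (not_le.2 hz)⟩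
    have hcl : IsClosed {x | cdf μ x ≤ t} := isClosed_le hF continuous_const
    have hmem := hcl.csSup_mem hne hbdd
    set s := sSup {x | cdf μ x ≤ t}
    have hIic : {x | cdf μ x ≤ t} = Iic s :=
      Subset.antisymm (fun x hx => le_csSup hbdd hx)
        fun x hx => (monotone_cdf μ hx).trans hmem
    have hge : t ≤ cdf μ s := by
      refine ge_of_tendsto (hF.continuousWithinAt (s := Ioi s) (x := s)) ?_
      filter_upwards [self_mem_nhdsWithin] with x hx
      by_contra h
      exact absurd (le_csSup hbdd (show x ∈ {x | cdf μ x ≤ t} from (not_le.1 h).le)) (not_le.2 hx)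
    rw [hIic, ← ofReal_cdf, le_antisymm hmem hge]

/-- If the distribution function `F` of `μ` is continuous, then `F` pushes `μ` forward to the
uniform distribution on `[0,1]`. -/
lemma map_cdf_eq_restrict_volume {μ : Measure ℝ} [IsProbabilityMeasure μ]
    (hF : Continuous (cdf μ)) : μ.map (cdf μ) = volume.restrict (Icc 0 1) := by
  have : IsProbabilityMeasure (μ.map (cdf μ)) :=
    Measure.isProbabilityMeasure_map hF.measurable.aemeasurable
  refine Measure.ext_of_Iic _ _ fun t => ?_
  rw [Measure.map_apply hF.measurable measurableSet_Iic, Measure.restrict_apply measurableSet_Iic]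
  have hpre : cdf μ ⁻¹' Iic t = {x | cdf μ x ≤ t} := rfl
  rw [hpre]
  rcases lt_or_ge t 0 with h0 | h0
  · have h1 : {x | cdf μ x ≤ t} = ∅ := eq_empty_of_forall_notMem fun x hx =>
      absurd ((cdf_nonneg μ x).trans hx) (not_le.2 h0)
    have h2 : Iic t ∩ Icc (0 : ℝ) 1 = ∅ := eq_empty_of_forall_notMem fun x hx =>
      absurd (hx.2.1.trans hx.1) (not_le.2 h0)
    rw [h1, h2, measure_empty, measure_empty]
  · rcases lt_or_ge t 1 with h1 | h1
    · have h2 : Iic t ∩ Icc (0 : ℝ) 1 = Icc 0 t := by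
        ext x
        simp only [mem_inter_iff, mem_Iic, mem_Icc]
        constructor
        · rintro ⟨a, b, c⟩
          exact ⟨b, a⟩
        · rintro ⟨a, b⟩
          exact ⟨b, a, by linarith⟩
      rw [measure_cdf_le_of_mem_Ico hF ⟨h0, h1⟩, h2, Real.volume_Icc, sub_zero]
    · have h2 : {x | cdf μ x ≤ t} = univ := eq_univ_of_forall fun x => (cdf_le_one μ x).trans h1
      have h3 : Iic t ∩ Icc (0 : ℝ) 1 = Icc 0 1 :=
        inter_eq_right.2 fun x hx => hx.2.trans h1
      rw [h2, h3, measure_univ, Real.volume_Icc]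
      simp

/-! ### Univariate marginals -/

section marginal

variable {d : ℕ} (i : Fin d)

lemma measurePreserving_insertCoord :
    MeasurePreserving (fun p : ℝ × ({j : Fin d // j ≠ i} → ℝ) => insertCoord i p.1 p.2) := by
  have h1 : MeasurePreserving
      (MeasurableEquiv.piEquivPiSubtypeProd (fun _ : Fin d => ℝ) (fun j => j = i)).symm
      volume volume := by
    convert (volume_preserving_piEquivPiSubtypeProd (fun _ : Fin d => ℝ) (fun j => j = i)).symm <;>
      rfl
  have h2 : MeasurePreserving (Prod.map (MeasurableEquiv.funUnique {j : Fin d // j = i} ℝ).symm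
      (id : ({j : Fin d // ¬ j = i} → ℝ) → _)) volume volume :=
    ((volume_preserving_funUnique {j : Fin d // j = i} ℝ).symm).prod (MeasurePreserving.id _)
  have h3 := h1.comp h2
  convert h3 using 1 <;> rfl

lemma continuous_insertCoord (t : ℝ) : Continuous (insertCoord i t) := by
  refine continuous_pi fun j => ?_
  unfold insertCoord
  split_ifs with h
  · exact continuous_const
  · exact continuous_apply _

lemma insertCoord_self (t : ℝ) (v : {j : Fin d // j ≠ i} → ℝ) : insertCoord i t v i = t := by
  simp [insertCoord]

lemma insertCoord_mem_cube {t : ℝ} {v : {j : Fin d // j ≠ i} → ℝ} :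
    insertCoord i t v ∈ cube d ↔ t ∈ Icc (0 : ℝ) 1 ∧ v ∈ Icc (0 : {j : Fin d // j ≠ i} → ℝ) 1 := by
  simp only [cube, mem_Icc, Pi.le_def, Pi.zero_apply, Pi.one_apply]
  constructor
  · rintro ⟨h0, h1⟩
    have ha := h0 i
    have hb := h1 i
    rw [insertCoord_self] at ha hb
    refine ⟨⟨ha, hb⟩, fun j => ?_, fun j => ?_⟩
    · simpa [insertCoord, j.2] using h0 j
    · simpa [insertCoord, j.2] using h1 j
  · rintro ⟨⟨h0, h1⟩, h2, h3⟩
    constructor <;> intro j <;> unfold insertCoord <;> split_ifs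
    exacts [h0, h2 _, h1, h3 _]

lemma setLIntegral_cube_eq {f : (Fin d → ℝ) → ℝ≥0∞} (hf : Measurable f) :
    ∫⁻ u in cube d, f u =
      ∫⁻ t in Icc (0 : ℝ) 1, ∫⁻ v in Icc (0 : {j : Fin d // j ≠ i} → ℝ) 1,
        f (insertCoord i t v) := by
  have hφ := measurePreserving_insertCoord i
  rw [← hφ.setLIntegral_comp_preimage (measurableSet_cube d) hf]
  have hpre : (fun p : ℝ × ({j : Fin d // j ≠ i} → ℝ) => insertCoord i p.1 p.2) ⁻¹' cube d =
      Icc (0 : ℝ) 1 ×ˢ Icc (0 : {j : Fin d // j ≠ i} → ℝ) 1 := by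
    ext p
    rw [mem_preimage, insertCoord_mem_cube, mem_prod]
  rw [hpre, Measure.volume_eq_prod, ← Measure.prod_restrict,
    lintegral_prod (fun p => f (insertCoord i p.1 p.2)) (hf.comp hφ.measurable).aemeasurable]

lemma volume_Icc_subtype : volume (Icc (0 : {j : Fin d // j ≠ i} → ℝ) 1) = 1 := by
  simp [Real.volume_Icc_pi]

lemma integrableOn_insertCoord {g : (Fin d → ℝ) → ℝ} (hg : Continuous g) (t : ℝ) :
    IntegrableOn (fun v => g (insertCoord i t v)) (Icc (0 : {j : Fin d // j ≠ i} → ℝ) 1) :=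
  (hg.comp (continuous_insertCoord i t)).continuousOn.integrableOn_compact isCompact_Icc

/-- If the `i`th coordinate of a law on the cube with continuous density `g` is uniform, then the
`i`th marginal of `g` equals one. -/
lemma marginal_eq_one_of_map_eval {g : (Fin d → ℝ) → ℝ} (hg : Continuous g)
    (hg0 : ∀ u ∈ cube d, 0 ≤ g u)
    (hmap : ((volume.restrict (cube d)).withDensity fun u => ENNReal.ofReal (g u)).map
      (fun u => u i) = volume.restrict (Icc 0 1)) :
    ∀ᵐ t ∂(volume.restrict (Icc (0 : ℝ) 1)), marginal g i t = 1 := by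
  have hgm : Measurable fun u => ENNReal.ofReal (g u) := hg.measurable.ennreal_ofReal
  have hφ := (measurePreserving_insertCoord i).measurable
  have key : (fun t => ∫⁻ v in Icc (0 : {j : Fin d // j ≠ i} → ℝ) 1,
      ENNReal.ofReal (g (insertCoord i t v))) =ᵐ[volume.restrict (Icc (0 : ℝ) 1)] fun _ => 1 := by
    refine ae_eq_of_forall_setLIntegral_eq_of_sigmaFinite
      (Measurable.lintegral_prod_right' (hgm.comp hφ)) measurable_const fun A hA _ => ?_
    have hA' := congrArg (fun m => m A) hmap
    rw [Measure.map_apply (measurable_pi_apply i) hA,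
      withDensity_apply _ (measurable_pi_apply i hA),
      ← lintegral_indicator (measurable_pi_apply i hA),
      setLIntegral_cube_eq i (hgm.indicator (measurable_pi_apply i hA))] at hA'
    rw [lintegral_const, one_mul, Measure.restrict_apply_univ, ← hA', ← lintegral_indicator hA]
    refine lintegral_congr fun t => ?_
    by_cases ht : t ∈ A
    · rw [indicator_of_mem ht]
      refine lintegral_congr fun v => ?_
      rw [indicator_of_mem]
      simpa [insertCoord_self] using ht
    · rw [indicator_of_notMem ht]
      symm
      rw [lintegral_eq_zero_iff' (by
        exact ((hgm.indicator (measurable_pi_apply i hA)).comp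
          (continuous_insertCoord i t).measurable).aemeasurable)]
      refine Eventually.of_forall fun v => ?_
      refine indicator_of_notMem ?_ _
      simpa [insertCoord_self] using ht
  filter_upwards [key, ae_restrict_mem measurableSet_Icc] with t ht htm
  rw [← ofReal_integral_eq_lintegral_ofReal (integrableOn_insertCoord i hg t)] at ht
  · rwa [ENNReal.ofReal_eq_one] at ht
  · filter_upwards [ae_restrict_mem measurableSet_Icc] with v hv
    exact hg0 _ ((insertCoord_mem_cube i).2 ⟨htm, hv⟩)

lemma abs_marginal_sub_le {g h : (Fin d → ℝ) → ℝ} (hg : Continuous g) (hh : Continuous h) {a : ℝ}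
    (hgh : ∀ u ∈ cube d, |h u - g u| ≤ a) {t : ℝ} (ht : t ∈ Icc (0 : ℝ) 1) :
    |marginal h i t - marginal g i t| ≤ a := by
  unfold marginal
  rw [← integral_sub (integrableOn_insertCoord i hh t) (integrableOn_insertCoord i hg t)]
  have := norm_setIntegral_le_of_norm_le_const (μ := volume)
    (s := Icc (0 : {j : Fin d // j ≠ i} → ℝ) 1)
    (f := fun v => h (insertCoord i t v) - g (insertCoord i t v)) (C := a)
    (by rw [volume_Icc_subtype]; exact ENNReal.one_lt_top)
    fun v hv => hgh _ ((insertCoord_mem_cube i).2 ⟨ht, hv⟩)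
  simpa [Measure.real, volume_Icc_subtype] using this

end marginal

lemma marginalDefect_nonneg {d : ℕ} (g : (Fin d → ℝ) → ℝ) : 0 ≤ marginalDefect g :=
  Finset.sum_nonneg fun _ _ => intervalIntegral.integral_nonneg zero_le_one fun _ _ => sq_nonneg _

/-- A function uniformly close to one with uniform marginals has a quadratically small defect. -/
lemma marginalDefect_le {d : ℕ} {g h : (Fin d → ℝ) → ℝ} (hg : Continuous g) (hh : Continuous h)
    {a : ℝ} (hgh : ∀ u ∈ cube d, |h u - g u| ≤ a)
    (hone : ∀ i, ∀ᵐ t ∂(volume.restrict (Icc (0 : ℝ) 1)), marginal g i t = 1) :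
    marginalDefect h ≤ d * a ^ 2 := by
  unfold marginalDefect
  refine (Finset.sum_le_card_nsmul _ _ (a ^ 2) fun i _ => ?_).trans (by simp)
  have h1 := intervalIntegral.norm_integral_le_of_norm_le_const_ae (a := 0) (b := 1) (C := a ^ 2)
    (f := fun t => (marginal h i t - 1) ^ 2) ?_
  · refine (le_abs_self _).trans ?_
    simpa using h1
  · have h2 := (ae_restrict_iff' measurableSet_Icc).1 (hone i)
    filter_upwards [h2] with t ht htm
    rw [uIoc_of_le zero_le_one] at htm
    have htm' : t ∈ Icc (0 : ℝ) 1 := Ioc_subset_Icc_self htm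
    have h3 := abs_marginal_sub_le i hg hh hgh htm'
    rw [ht htm'] at h3
    rw [Real.norm_eq_abs, abs_of_nonneg (sq_nonneg _), ← sq_abs]
    gcongr

/-! ### Concentration of class-wise empirical quantities -/

section concentration

variable {Ω : Type*} [MeasurableSpace Ω] {P : Measure Ω} [IsProbabilityMeasure P]

/-- Hoeffding's inequality, two-sided, for i.i.d. centred variables bounded by one. -/
lemma measure_le_abs_sum_le {α : Type*} [MeasurableSpace α] {W : ℕ → Ω → α}
    (hW : ∀ i, Measurable (W i)) (hindep : iIndepFun W P)
    (hident : ∀ i, IdentDistrib (W i) (W 0) P P) {f : α → ℝ} (hf : Measurable f)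
    (hf1 : ∀ a, |f a| ≤ 1) (hf0 : ∫ ω, f (W 0 ω) ∂P = 0) (n : ℕ) {t : ℝ} (ht : 0 ≤ t) :
    P {ω | n * t ≤ |∑ i ∈ Finset.range n, f (W i ω)|} ≤
      ENNReal.ofReal (2 * Real.exp (-(n * t ^ 2 / 2))) := by
  have hmean : ∀ i, ∫ ω, f (W i ω) ∂P = 0 := fun i => by
    rw [← hf0]
    exact ((hident i).comp hf).integral_eq
  have key : ∀ g : α → ℝ, Measurable g → (∀ a, |g a| ≤ 1) → (∀ i, ∫ ω, g (W i ω) ∂P = 0) →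
      P {ω | n * t ≤ ∑ i ∈ Finset.range n, g (W i ω)} ≤
        ENNReal.ofReal (Real.exp (-(n * t ^ 2 / 2))) := by
    intro g hg hg1 hg0
    have hsub : ∀ i < n, HasSubgaussianMGF (fun ω => g (W i ω)) 1 P := by
      intro i _
      have h := hasSubgaussianMGF_of_mem_Icc_of_integral_eq_zero (μ := P) (a := -1) (b := 1)
        (X := fun ω => g (W i ω)) (hg.comp (hW i)).aemeasurable
        (Eventually.of_forall fun ω => abs_le.1 (hg1 _)) (hg0 i)
      convert h using 1
      ext
      norm_num
    have h := HasSubgaussianMGF.measure_sum_range_ge_le_of_iIndepFun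
      (hindep.comp (fun _ => g) fun _ => hg) hsub (ε := n * t) (by positivity)
    rw [← ENNReal.ofReal_toReal (measure_ne_top P _)]
    refine ENNReal.ofReal_le_ofReal (h.trans (le_of_eq ?_))
    congr 1
    rcases Nat.eq_zero_or_pos n with rfl | hn
    · simp
    · have : (n : ℝ) ≠ 0 := by positivity
      push_cast
      field_simp
  calc P {ω | n * t ≤ |∑ i ∈ Finset.range n, f (W i ω)|}
      ≤ P ({ω | n * t ≤ ∑ i ∈ Finset.range n, f (W i ω)} ∪
          {ω | n * t ≤ ∑ i ∈ Finset.range n, (fun a => -f a) (W i ω)}) := by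
        refine measure_mono fun ω hω => ?_
        simpa [le_abs] using hω
    _ ≤ ENNReal.ofReal (Real.exp (-(n * t ^ 2 / 2))) +
          ENNReal.ofReal (Real.exp (-(n * t ^ 2 / 2))) := by
        refine (measure_union_le _ _).trans (add_le_add (key f hf hf1 hmean)
          (key (fun a => -f a) hf.neg (fun a => by rw [abs_neg]; exact hf1 a) fun i => ?_))
        rw [integral_neg, hmean, neg_zero]
    _ = _ := by
        rw [← ENNReal.ofReal_add (Real.exp_pos _).le (Real.exp_pos _).le, two_mul]

variable {d K : ℕ} {X : ℕ → Ω → Fin d → ℝ} {Y : ℕ → Ω → Fin K} {y : Fin K}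

omit [MeasurableSpace Ω] in
lemma classCount_le (n : ℕ) (ω : Ω) : classCount Y y n ω ≤ n :=
  (Finset.card_filter_le _ _).trans (by simp)

/-- The number of observations of class `y` whose `j`th coordinate is at most `x`. -/
noncomputable def classCountLe (X : ℕ → Ω → Fin d → ℝ) (Y : ℕ → Ω → Fin K) (y : Fin K) (n : ℕ)
    (ω : Ω) (j : Fin d) (x : ℝ) : ℕ :=
  ((classIndices Y y n ω).filter (fun i => X i ω j ≤ x)).card

omit [MeasurableSpace Ω] in
lemma classCountLe_mono (n : ℕ) (ω : Ω) (j : Fin d) : Monotone (classCountLe X Y y n ω j) :=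
  fun _ _ h => Finset.card_le_card <|
    Finset.monotone_filter_right _ fun _ _ hi => hi.trans h

omit [MeasurableSpace Ω] in
lemma classCountLe_le (n : ℕ) (ω : Ω) (j : Fin d) (x : ℝ) :
    classCountLe X Y y n ω j x ≤ classCount Y y n ω :=
  Finset.card_filter_le _ _

omit [MeasurableSpace Ω] in
lemma classCount_eq_sum (n : ℕ) (ω : Ω) : (classCount Y y n ω : ℝ) =
    ∑ i ∈ Finset.range n, ({w : (Fin d → ℝ) × Fin K | w.2 = y}).indicator (fun _ => (1 : ℝ))
      (X i ω, Y i ω) := by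
  rw [classCount, classIndices, Finset.card_filter, Nat.cast_sum]
  refine Finset.sum_congr rfl fun i _ => ?_
  by_cases h : Y i ω = y <;> simp [h]

omit [MeasurableSpace Ω] in
lemma classCountLe_eq_sum (n : ℕ) (ω : Ω) (j : Fin d) (x : ℝ) :
    (classCountLe X Y y n ω j x : ℝ) =
    ∑ i ∈ Finset.range n, ({w : (Fin d → ℝ) × Fin K | w.2 = y ∧ w.1 j ≤ x}).indicator
      (fun _ => (1 : ℝ)) (X i ω, Y i ω) := by
  rw [classCountLe, classIndices, Finset.filter_filter, Finset.card_filter, Nat.cast_sum]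
  refine Finset.sum_congr rfl fun i _ => ?_
  by_cases h : Y i ω = y ∧ X i ω j ≤ x
  · rw [if_pos h, indicator_of_mem (by exact h), Nat.cast_one]
  · rw [if_neg h, indicator_of_notMem (by exact h), Nat.cast_zero]

lemma measurableSet_class : MeasurableSet {w : (Fin d → ℝ) × Fin K | w.2 = y} :=
  measurable_snd (measurableSet_singleton y)

lemma measurableSet_class_le (j : Fin d) (x : ℝ) :
    MeasurableSet {w : (Fin d → ℝ) × Fin K | w.2 = y ∧ w.1 j ≤ x} :=
  measurableSet_class.inter (((measurable_pi_apply j).comp measurable_fst) measurableSet_Iic)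

lemma classCDF_mul_eq {X : Ω → Fin d → ℝ} {Y : Ω → Fin K} (hX : Measurable X) (hY : Measurable Y)
    (hy : P (Y ⁻¹' {y}) ≠ 0) (j : Fin d) (x : ℝ) :
    classCDF P X Y y j x * P.real (Y ⁻¹' {y}) = P.real {ω | Y ω = y ∧ X ω j ≤ x} := by
  have hXj : Measurable fun ω => X ω j := (measurable_pi_apply j).comp hX
  have : IsProbabilityMeasure (cond P (Y ⁻¹' {y})) := cond_isProbabilityMeasure hy
  have : IsProbabilityMeasure ((cond P (Y ⁻¹' {y})).map fun ω => X ω j) :=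
    Measure.isProbabilityMeasure_map hXj.aemeasurable
  have hne : P.real (Y ⁻¹' {y}) ≠ 0 := (measureReal_ne_zero_iff (measure_ne_top _ _)).2 hy
  unfold classCDF
  rw [cdf_eq_real, map_measureReal_apply hXj measurableSet_Iic, Measure.real,
    cond_apply (hY (measurableSet_singleton y)), ENNReal.toReal_mul, ENNReal.toReal_inv, mul_comm]
  exact mul_inv_cancel_left₀ hne _

variable (hX : ∀ i, Measurable (X i)) (hY : ∀ i, Measurable (Y i))
    (hindep : iIndepFun (fun i ω => (X i ω, Y i ω)) P)
    (hident : ∀ i, IdentDistrib (fun ω => (X i ω, Y i ω)) (fun ω => (X 0 ω, Y 0 ω)) P P)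

include hX hY hindep hident

/-- The class count is at least half its expectation, up to an exponentially small probability. -/
lemma measure_classCount_le (n : ℕ) :
    P {ω | (classCount Y y n ω : ℝ) ≤ n * (P.real (Y 0 ⁻¹' {y}) / 2)} ≤
      ENNReal.ofReal (2 * Real.exp (-(n * (P.real (Y 0 ⁻¹' {y}) / 2) ^ 2 / 2))) := by
  set p := P.real (Y 0 ⁻¹' {y})
  have hp0 : 0 ≤ p := measureReal_nonneg
  have hp1 : p ≤ 1 := measureReal_le_one
  set f : (Fin d → ℝ) × Fin K → ℝ :=
    fun w => ({w : (Fin d → ℝ) × Fin K | w.2 = y}).indicator (fun _ => (1 : ℝ)) w - p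
  refine (measure_mono fun ω hω => ?_).trans (measure_le_abs_sum_le
    (fun i => (hX i).prodMk (hY i)) hindep hident (f := f)
    ((measurable_const.indicator measurableSet_class).sub_const _) ?_ ?_ n
    (t := p / 2) (by positivity))
  · simp only [mem_ofPred_eq, f, Finset.sum_sub_distrib, ← classCount_eq_sum] at hω ⊢
    rw [Finset.sum_const, Finset.card_range, nsmul_eq_mul, abs_sub_comm]
    refine le_trans ?_ (le_abs_self _)
    linarith
  · intro w
    simp only [f, indicator_apply]
    rw [abs_le]
    split_ifs <;> constructor <;> linarith
  · have hi : Integrable (fun ω => ({w : (Fin d → ℝ) × Fin K | w.2 = y}).indicator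
        (fun _ => (1 : ℝ)) (X 0 ω, Y 0 ω)) P :=
      Integrable.of_mem_Icc 0 1 ((measurable_const.indicator measurableSet_class).comp
        ((hX 0).prodMk (hY 0))).aemeasurable (Eventually.of_forall fun ω => by
          simp only [indicator_apply]; split_ifs <;> simp)
    simp only [f]
    rw [integral_sub hi (integrable_const _), integral_const, probReal_univ, one_smul]
    have : (fun ω => ({w : (Fin d → ℝ) × Fin K | w.2 = y}).indicator
        (fun _ => (1 : ℝ)) (X 0 ω, Y 0 ω)) = (Y 0 ⁻¹' {y}).indicator 1 := by
      ext ω; by_cases h : Y 0 ω = y <;> simp [h]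
    rw [this, integral_indicator_one (hY 0 (measurableSet_singleton y)), sub_self]

variable (hy : P (Y 0 ⁻¹' {y}) ≠ 0)

include hy

lemma measure_classCountLe_sub_le (n : ℕ) (j : Fin d) (x : ℝ) {t : ℝ} (ht : 0 ≤ t) :
    P {ω | n * t ≤ |(classCountLe X Y y n ω j x : ℝ) -
        classCDF P (X 0) (Y 0) y j x * classCount Y y n ω|} ≤
      ENNReal.ofReal (2 * Real.exp (-(n * t ^ 2 / 2))) := by
  set F := classCDF P (X 0) (Y 0) y j x
  have hF0 : 0 ≤ F := cdf_nonneg _ _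
  have hF1 : F ≤ 1 := cdf_le_one _ _
  set f : (Fin d → ℝ) × Fin K → ℝ := fun w =>
    ({w : (Fin d → ℝ) × Fin K | w.2 = y ∧ w.1 j ≤ x}).indicator (fun _ => (1 : ℝ)) w -
      F * ({w : (Fin d → ℝ) × Fin K | w.2 = y}).indicator (fun _ => (1 : ℝ)) w
  have hm1 : Measurable (({w : (Fin d → ℝ) × Fin K | w.2 = y ∧ w.1 j ≤ x}).indicator
      fun _ => (1 : ℝ)) := measurable_const.indicator (measurableSet_class_le j x)
  have hm2 : Measurable (({w : (Fin d → ℝ) × Fin K | w.2 = y}).indicator fun _ => (1 : ℝ)) :=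
    measurable_const.indicator measurableSet_class
  refine (measure_mono fun ω hω => ?_).trans (measure_le_abs_sum_le
    (fun i => (hX i).prodMk (hY i)) hindep hident (f := f)
    (hm1.sub (hm2.const_mul _)) ?_ ?_ n ht)
  · simpa only [mem_ofPred_eq, f, Finset.sum_sub_distrib, ← classCount_eq_sum, ← Finset.mul_sum,
      ← classCountLe_eq_sum] using hω
  · intro w
    simp only [f, indicator_apply, mem_ofPred_eq]
    rw [abs_le]
    by_cases h1 : w.2 = y <;> by_cases h2 : w.1 j ≤ x <;> simp only [h1, h2] <;>
      constructor <;> norm_num <;> linarith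
  · have hi1 : Integrable (fun ω => ({w : (Fin d → ℝ) × Fin K | w.2 = y ∧ w.1 j ≤ x}).indicator
        (fun _ => (1 : ℝ)) (X 0 ω, Y 0 ω)) P :=
      Integrable.of_mem_Icc 0 1 (hm1.comp ((hX 0).prodMk (hY 0))).aemeasurable
        (Eventually.of_forall fun ω => by simp only [indicator_apply]; split_ifs <;> simp)
    have hi2 : Integrable (fun ω => ({w : (Fin d → ℝ) × Fin K | w.2 = y}).indicator
        (fun _ => (1 : ℝ)) (X 0 ω, Y 0 ω)) P :=
      Integrable.of_mem_Icc 0 1 (hm2.comp ((hX 0).prodMk (hY 0))).aemeasurable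
        (Eventually.of_forall fun ω => by simp only [indicator_apply]; split_ifs <;> simp)
    simp only [f]
    rw [integral_sub hi1 (hi2.const_mul _), integral_const_mul]
    have h1 : (fun ω => ({w : (Fin d → ℝ) × Fin K | w.2 = y ∧ w.1 j ≤ x}).indicator
        (fun _ => (1 : ℝ)) (X 0 ω, Y 0 ω)) = {ω | Y 0 ω = y ∧ X 0 ω j ≤ x}.indicator 1 := by
      ext ω; by_cases h : Y 0 ω = y <;> by_cases h' : X 0 ω j ≤ x <;> simp [h, h']
    have h2 : (fun ω => ({w : (Fin d → ℝ) × Fin K | w.2 = y}).indicator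
        (fun _ => (1 : ℝ)) (X 0 ω, Y 0 ω)) = (Y 0 ⁻¹' {y}).indicator 1 := by
      ext ω; by_cases h : Y 0 ω = y <;> simp [h]
    have h3 : MeasurableSet {ω | Y 0 ω = y ∧ X 0 ω j ≤ x} :=
      ((hX 0).prodMk (hY 0)) (measurableSet_class_le j x)
    rw [h1, h2, integral_indicator_one (hY 0 (measurableSet_singleton y)),
      integral_indicator_one h3,
      classCDF_mul_eq (hX 0) (hY 0) hy, sub_self]

omit hX hY hindep hident hy in
/-- A uniform bound from a bound at the `l / m` quantiles. -/
lemma abs_sub_mul_le_of_grid {N F : ℝ → ℝ} {a s : ℝ} {m : ℕ} (hm : 0 < m) (hN : Monotone N)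
    (hN0 : ∀ x, 0 ≤ N x) (hNa : ∀ x, N x ≤ a) (hF : Monotone F) (hF0 : ∀ x, 0 ≤ F x)
    (hF1 : ∀ x, F x ≤ 1) (hs : 0 ≤ s) {ξ : ℕ → ℝ} (hξ : ∀ l, 0 < l → l < m → F (ξ l) = l / m)
    (hgrid : ∀ l, 0 < l → l < m → |N (ξ l) - F (ξ l) * a| ≤ s) (x : ℝ) :
    |N x - F x * a| ≤ s + a / m := by
  have hm' : (0 : ℝ) < m := by exact_mod_cast hm
  have ha : 0 ≤ a := (hN0 x).trans (hNa x)
  have hmF : 0 ≤ m * F x := mul_nonneg hm'.le (hF0 x)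
  rw [abs_le]
  constructor
  · set l := ⌈m * F x⌉₊ - 1 with hl
    rcases Nat.eq_zero_or_pos l with h0 | h0
    · have h1 : (m : ℝ) * F x ≤ 1 := by
        have : ⌈m * F x⌉₊ ≤ 1 := by omega
        exact_mod_cast Nat.ceil_le.1 this
      have h2 : F x * a ≤ a / m := by
        rw [le_div_iff₀ hm']
        nlinarith
      linarith [hN0 x]
    · have hlt : (l : ℝ) < m * F x := Nat.lt_ceil.1 (by omega)
      have hle : m * F x ≤ l + 1 := by
        have := Nat.le_ceil (m * F x)
        have h2 : ⌈m * F x⌉₊ = l + 1 := by omega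
        rw [h2] at this
        exact_mod_cast this
      have hlm : l < m := by
        have : (l : ℝ) < m := by nlinarith [hF1 x]
        exact_mod_cast this
      have hFl := hξ l h0 hlm
      have hlx : F (ξ l) < F x := by rw [hFl, div_lt_iff₀ hm']; linarith
      have h3 := hN (hF.reflect_lt hlx).le
      have h4 := (abs_le.1 (hgrid l h0 hlm)).1
      have h5 : F x * a ≤ F (ξ l) * a + a / m := by
        rw [hFl, div_mul_eq_mul_div, ← add_div, le_div_iff₀ hm']
        nlinarith
      linarith
  · set l := ⌊m * F x⌋₊ + 1 with hl
    have hlt : m * F x < l := by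
      have := Nat.lt_floor_add_one (m * F x)
      rw [hl]
      exact_mod_cast this
    have hle : (l : ℝ) ≤ m * F x + 1 := by
      have := Nat.floor_le hmF
      rw [hl]
      push_cast
      linarith
    rcases lt_or_ge l m with hlm | hlm
    · have hFl := hξ l (by omega) hlm
      have hlx : F x < F (ξ l) := by rw [hFl, lt_div_iff₀ hm']; linarith
      have h3 := hN (hF.reflect_lt hlx).le
      have h4 := (abs_le.1 (hgrid l (by omega) hlm)).2
      have h5 : F (ξ l) * a ≤ F x * a + a / m := by
        rw [hFl, div_mul_eq_mul_div, div_le_iff₀ hm', add_mul, div_mul_cancel₀ _ hm'.ne']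
        nlinarith
      linarith
    · have h6 : (m : ℝ) ≤ l := by exact_mod_cast hlm
      have h5 : a ≤ F x * a + a / m := by
        have : a * m ≤ (F x * a + a / m) * m := by
          rw [add_mul, div_mul_cancel₀ _ hm'.ne']
          nlinarith
        exact le_of_mul_le_mul_right this hm'
      linarith [hNa x]

/-- Uniform deviation of the class-wise counts from their conditional means. -/
lemma measure_exists_lt_abs_classCountLe_sub_le
    (hF : ∀ j, Continuous (classCDF P (X 0) (Y 0) y j)) {n : ℕ} (hn : 0 < n) {t : ℝ} (ht : 0 ≤ t) :
    P {ω | ∃ j x, n * t + 1 < |(classCountLe X Y y n ω j x : ℝ) -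
        classCDF P (X 0) (Y 0) y j x * classCount Y y n ω|} ≤
      ENNReal.ofReal (d * n * (2 * Real.exp (-(n * t ^ 2 / 2)))) := by
  have hn' : (0 : ℝ) < n := by exact_mod_cast hn
  have hgrid : ∀ (j : Fin d) (l : ℕ), ∃ x, 0 < l → l < n →
      classCDF P (X 0) (Y 0) y j x = l / n := by
    intro j l
    by_cases h : 0 < l ∧ l < n
    · obtain ⟨x₁, h₁⟩ := ((tendsto_cdf_atBot
        ((cond P (Y 0 ⁻¹' {y})).map fun ω => X 0 ω j)).eventually
        (gt_mem_nhds (show (0 : ℝ) < l / n by have := h.1; positivity))).exists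
      obtain ⟨x₂, h₂⟩ := ((tendsto_cdf_atTop
        ((cond P (Y 0 ⁻¹' {y})).map fun ω => X 0 ω j)).eventually
        (lt_mem_nhds (show (l : ℝ) / n < 1 by
          rw [div_lt_one hn']; exact_mod_cast h.2))).exists
      obtain ⟨x, hx⟩ := mem_range_of_exists_le_of_exists_ge (hF j) ⟨x₁, h₁.le⟩ ⟨x₂, h₂.le⟩
      exact ⟨x, fun _ _ => hx⟩
    · exact ⟨0, fun h1 h2 => absurd ⟨h1, h2⟩ h⟩
  choose ξ hξ using hgrid
  calc _ ≤ P (⋃ q ∈ (Finset.univ : Finset (Fin d)) ×ˢ Finset.range n,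
        {ω | n * t ≤ |(classCountLe X Y y n ω q.1 (ξ q.1 q.2) : ℝ) -
          classCDF P (X 0) (Y 0) y q.1 (ξ q.1 q.2) * classCount Y y n ω|}) := by
        refine measure_mono ?_
        rintro ω ⟨j, x, hx⟩
        by_contra hcon
        simp only [mem_iUnion, mem_ofPred_eq, not_exists, not_le] at hcon
        have := abs_sub_mul_le_of_grid (N := fun x => (classCountLe X Y y n ω j x : ℝ))
          (F := classCDF P (X 0) (Y 0) y j) (a := classCount Y y n ω) (s := n * t) hn
          (fun _ _ h => Nat.cast_le.2 (classCountLe_mono n ω j h)) (fun _ => by positivity)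
          (fun x => by exact_mod_cast classCountLe_le n ω j x) (monotone_cdf _)
          (cdf_nonneg _) (cdf_le_one _) (by positivity) (hξ j)
          (fun l _ hl => (hcon (j, l) (by simpa using hl)).le) x
        have h1 : (classCount Y y n ω : ℝ) / n ≤ 1 := by
          rw [div_le_one hn']
          exact_mod_cast classCount_le n ω
        linarith
    _ ≤ ∑ _q ∈ (Finset.univ : Finset (Fin d)) ×ˢ Finset.range n,
          ENNReal.ofReal (2 * Real.exp (-(n * t ^ 2 / 2))) :=
        (measure_biUnion_finset_le _ _).trans (Finset.sum_le_sum fun q _ =>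
          measure_classCountLe_sub_le hX hY hindep hident hy n q.1 _ ht)
    _ = _ := by
        rw [Finset.sum_const, Finset.card_product, Finset.card_univ, Fintype.card_fin,
          Finset.card_range, ← Nat.cast_mul, ENNReal.ofReal_mul (Nat.cast_nonneg _),
          ENNReal.ofReal_natCast, nsmul_eq_mul]

end concentration

/-! ### Likelihood ratios -/

section likelihood

variable {Ω : Type*} [MeasurableSpace Ω] {P : Measure Ω} {d K : ℕ}

lemma classCDF_mem_cube (X : Ω → Fin d → ℝ) (Y : Ω → Fin K) (y : Fin K) (x : Fin d → ℝ) :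
    (fun j => classCDF P X Y y j (x j)) ∈ cube d :=
  ⟨fun _ => cdf_nonneg _ _, fun _ => cdf_le_one _ _⟩

variable [IsProbabilityMeasure P] {y : Fin K}

/-- The expected density ratio, when the true density is at most `A` times the denominator. -/
lemma setLIntegral_ratio_le {X : Ω → Fin d → ℝ} {Y : Ω → Fin K} (hX : Measurable X)
    (hy : P (Y ⁻¹' {y}) ≠ 0) (hF : ∀ j, Continuous (classCDF P X Y y j))
    {c : (Fin d → ℝ) → ℝ} (hc : IsCopulaDensity P X Y y c) (θ θ' : ReLUNet d) {A : ℝ}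
    (hA : 0 ≤ A) (hcA : ∀ u ∈ cube d, c u ≤ A * neuralDensity θ' u) :
    ∫⁻ ω in Y ⁻¹' {y}, ENNReal.ofReal (neuralDensity θ (fun j => classCDF P X Y y j (X ω j)) /
      neuralDensity θ' (fun j => classCDF P X Y y j (X ω j))) ∂P ≤
      ENNReal.ofReal A * P (Y ⁻¹' {y}) := by
  set ρ : (Fin d → ℝ) → ℝ≥0∞ := fun u => ENNReal.ofReal (neuralDensity θ u / neuralDensity θ' u)
  have hρ : Measurable ρ := ((continuous_neuralDensity θ).measurable.div
    (continuous_neuralDensity θ').measurable).ennreal_ofReal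
  have hU : Measurable fun ω (j : Fin d) => classCDF P X Y y j (X ω j) :=
    measurable_pi_lambda _ fun j => (hF j).measurable.comp ((measurable_pi_apply j).comp hX)
  have hcond : ∫⁻ ω, ρ (fun j => classCDF P X Y y j (X ω j)) ∂(cond P (Y ⁻¹' {y})) ≤
      ENNReal.ofReal A := by
    rw [← lintegral_map hρ hU, hc.2]
    calc _ ≤ ∫⁻ u, ρ u ∂((volume.restrict (cube d)).withDensity
          fun u => ENNReal.ofReal (A * neuralDensity θ' u)) := by
          refine lintegral_mono' (withDensity_mono ?_) le_rfl
          filter_upwards [ae_restrict_mem (measurableSet_cube d)] with u hu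
          exact ENNReal.ofReal_le_ofReal (hcA u hu)
      _ = ∫⁻ u in cube d, ENNReal.ofReal (A * neuralDensity θ u) := by
          rw [lintegral_withDensity_eq_lintegral_mul _
            ((continuous_neuralDensity θ').measurable.const_mul A).ennreal_ofReal hρ]
          refine lintegral_congr fun u => ?_
          have h1 := neuralDensity_pos θ u
          have h2 := neuralDensity_pos θ' u
          simp only [Pi.mul_apply, ρ]
          rw [← ENNReal.ofReal_mul (by positivity)]
          congr 1
          field_simp
      _ = ENNReal.ofReal A := by
          rw [← ofReal_integral_eq_lintegral_ofReal ((integrableOn_neuralDensity θ).const_mul A)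
            (Eventually.of_forall fun u => mul_nonneg hA (neuralDensity_pos θ u).le),
            integral_const_mul, integral_neuralDensity, mul_one]
  have hne : P (Y ⁻¹' {y}) ≠ ⊤ := measure_ne_top _ _
  rw [ProbabilityTheory.cond, lintegral_smul_measure, smul_eq_mul] at hcond
  calc _ = P (Y ⁻¹' {y}) * ((P (Y ⁻¹' {y}))⁻¹ * ∫⁻ ω in Y ⁻¹' {y},
        ρ (fun j => classCDF P X Y y j (X ω j)) ∂P) := by
        rw [← mul_assoc, ENNReal.mul_inv_cancel hy hne, one_mul]
    _ ≤ _ := by rw [mul_comm]; gcongr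

variable {X : ℕ → Ω → Fin d → ℝ} {Y : ℕ → Ω → Fin K}
    (hX : ∀ i, Measurable (X i)) (hY : ∀ i, Measurable (Y i))
    (hindep : iIndepFun (fun i ω => (X i ω, Y i ω)) P)
    (hident : ∀ i, IdentDistrib (fun ω => (X i ω, Y i ω)) (fun ω => (X 0 ω, Y 0 ω)) P P)
    (hy : P (Y 0 ⁻¹' {y}) ≠ 0)
    (hF : ∀ j, Continuous (classCDF P (X 0) (Y 0) y j))
    {c : (Fin d → ℝ) → ℝ} (hc : IsCopulaDensity P (X 0) (Y 0) y c)

include hX hY hindep hident hy hF hc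

/-- A Chernoff bound for the log-likelihood ratio at the true probability integral transforms. -/
lemma measure_le_sum_log_ratio_le (θ θ' : ReLUNet d) {A : ℝ} (hA : 1 ≤ A)
    (hcA : ∀ u ∈ cube d, c u ≤ A * neuralDensity θ' u) (n : ℕ) (s : ℝ) :
    P {ω | s ≤ ∑ i ∈ classIndices Y y n ω,
      (Real.log (neuralDensity θ fun j => classCDF P (X 0) (Y 0) y j (X i ω j)) -
        Real.log (neuralDensity θ' fun j => classCDF P (X 0) (Y 0) y j (X i ω j)))} ≤
      ENNReal.ofReal (A ^ n * Real.exp (-s)) := by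
  classical
  set U : (Fin d → ℝ) → Fin d → ℝ := fun x j => classCDF P (X 0) (Y 0) y j (x j)
  have hU : Measurable U :=
    measurable_pi_lambda _ fun j => (hF j).measurable.comp (measurable_pi_apply j)
  set h : (Fin d → ℝ) × Fin K → ℝ≥0∞ := fun w =>
    if w.2 = y then ENNReal.ofReal (neuralDensity θ (U w.1) / neuralDensity θ' (U w.1)) else 1
  have hh : Measurable h := by
    refine Measurable.ite measurableSet_class ?_ measurable_const
    exact (((continuous_neuralDensity θ).measurable.comp (hU.comp measurable_fst)).div
      ((continuous_neuralDensity θ').measurable.comp (hU.comp measurable_fst))).ennreal_ofReal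
  have hW : ∀ i, Measurable fun ω => h (X i ω, Y i ω) := fun i =>
    hh.comp ((hX i).prodMk (hY i))
  have hmean : ∀ i, ∫⁻ ω, h (X i ω, Y i ω) ∂P ≤ ENNReal.ofReal A := by
    intro i
    have h0 : ∫⁻ ω, h (X i ω, Y i ω) ∂P = ∫⁻ ω, h (X 0 ω, Y 0 ω) ∂P :=
      ((hident i).comp hh).lintegral_eq
    have hms : MeasurableSet (Y 0 ⁻¹' {y}) := hY 0 (measurableSet_singleton y)
    rw [h0, ← lintegral_add_compl _ hms]
    have e1 : ∫⁻ ω in Y 0 ⁻¹' {y}, h (X 0 ω, Y 0 ω) ∂P ≤ ENNReal.ofReal A * P (Y 0 ⁻¹' {y}) := by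
      refine le_trans (le_of_eq ?_)
        (setLIntegral_ratio_le (hX 0) hy hF hc θ θ' (zero_le_one.trans hA) hcA)
      refine setLIntegral_congr_fun hms fun ω hω => ?_
      exact if_pos hω
    have e2 : ∫⁻ ω in (Y 0 ⁻¹' {y})ᶜ, h (X 0 ω, Y 0 ω) ∂P ≤
        ENNReal.ofReal A * P (Y 0 ⁻¹' {y})ᶜ := by
      have : ∫⁻ ω in (Y 0 ⁻¹' {y})ᶜ, h (X 0 ω, Y 0 ω) ∂P = ∫⁻ _ω in (Y 0 ⁻¹' {y})ᶜ, 1 ∂P :=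
        setLIntegral_congr_fun hms.compl fun ω hω => if_neg hω
      rw [this, lintegral_const, Measure.restrict_apply_univ]
      gcongr
      exact ENNReal.one_le_ofReal.2 hA
    refine (add_le_add e1 e2).trans (le_of_eq ?_)
    rw [← mul_add, measure_add_measure_compl hms, measure_univ, mul_one]
  have hprod : ∫⁻ ω, ∏ i ∈ Finset.range n, h (X i ω, Y i ω) ∂P ≤ ENNReal.ofReal (A ^ n) := by
    rw [lintegral_prod_eq_prod_lintegral_of_indepFun (Finset.range n)
      (fun i ω => h (X i ω, Y i ω)) (hindep.comp (fun _ => h) fun _ => hh) hW,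
      ENNReal.ofReal_pow (by linarith)]
    exact (Finset.prod_le_prod' fun i _ => hmean i).trans (by simp)
  have hexp : ∀ ω, ∏ i ∈ Finset.range n, h (X i ω, Y i ω) =
      ENNReal.ofReal (Real.exp (∑ i ∈ classIndices Y y n ω,
        (Real.log (neuralDensity θ (U (X i ω))) - Real.log (neuralDensity θ' (U (X i ω)))))) := by
    intro ω
    rw [Real.exp_sum, ENNReal.ofReal_prod_of_nonneg fun i _ => (Real.exp_pos _).le, classIndices,
      Finset.prod_filter]
    refine Finset.prod_congr rfl fun i _ => ?_
    simp only [h]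
    split_ifs
    · rw [Real.exp_sub, Real.exp_log (neuralDensity_pos _ _), Real.exp_log (neuralDensity_pos _ _)]
    · rfl
  have hmarkov := mul_meas_ge_le_lintegral (μ := P)
    (Finset.measurable_prod (Finset.range n) fun i _ => hW i) (ENNReal.ofReal (Real.exp s))
  have hset : P {ω | s ≤ ∑ i ∈ classIndices Y y n ω,
      (Real.log (neuralDensity θ (U (X i ω))) - Real.log (neuralDensity θ' (U (X i ω))))} ≤
      P {ω | ENNReal.ofReal (Real.exp s) ≤ ∏ i ∈ Finset.range n, h (X i ω, Y i ω)} := by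
    refine measure_mono fun ω hω => ?_
    simp only [mem_ofPred_eq] at hω ⊢
    rw [hexp]
    exact ENNReal.ofReal_le_ofReal (Real.exp_le_exp.2 hω)
  refine hset.trans ?_
  have hs : ENNReal.ofReal (Real.exp s) ≠ 0 := by simp [Real.exp_pos]
  have hle : P {ω | ENNReal.ofReal (Real.exp s) ≤ ∏ i ∈ Finset.range n, h (X i ω, Y i ω)} ≤
      ENNReal.ofReal (A ^ n) / ENNReal.ofReal (Real.exp s) := by
    rw [ENNReal.le_div_iff_mul_le (Or.inl hs) (Or.inl ENNReal.ofReal_ne_top), mul_comm]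
    exact hmarkov.trans hprod
  refine hle.trans (le_of_eq ?_)
  rw [← ENNReal.ofReal_div_of_pos (Real.exp_pos s), Real.exp_neg, div_eq_mul_inv]

lemma measure_exists_le_sum_log_ratio_le (G : Finset (ReLUNet d)) (θ' : ReLUNet d) {A : ℝ}
    (hA : 1 ≤ A) (hcA : ∀ u ∈ cube d, c u ≤ A * neuralDensity θ' u) (n : ℕ) (s : ℝ) :
    P {ω | ∃ θ ∈ G, s ≤ ∑ i ∈ classIndices Y y n ω,
      (Real.log (neuralDensity θ fun j => classCDF P (X 0) (Y 0) y j (X i ω j)) -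
        Real.log (neuralDensity θ' fun j => classCDF P (X 0) (Y 0) y j (X i ω j)))} ≤
      ENNReal.ofReal (G.card * (A ^ n * Real.exp (-s))) := by
  refine (measure_mono (t := ⋃ θ ∈ G, {ω | s ≤ ∑ i ∈ classIndices Y y n ω,
      (Real.log (neuralDensity θ fun j => classCDF P (X 0) (Y 0) y j (X i ω j)) -
        Real.log (neuralDensity θ' fun j => classCDF P (X 0) (Y 0) y j (X i ω j)))})
    fun ω hω => ?_).trans ?_
  · obtain ⟨θ, hθ, h⟩ := hω
    exact mem_biUnion hθ h
  · refine (measure_biUnion_finset_le _ _).trans ((Finset.sum_le_sum fun θ _ =>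
      measure_le_sum_log_ratio_le hX hY hindep hident hy hF hc θ θ' hA hcA n s).trans ?_)
    rw [Finset.sum_const, ENNReal.ofReal_mul (Nat.cast_nonneg _), ENNReal.ofReal_natCast,
      nsmul_eq_mul]

omit hX hY hindep hident hy hF hc in
lemma integral_eq_one_of_isCopulaDensity {X : Ω → Fin d → ℝ} {Y : Ω → Fin K} (hX : Measurable X)
    (hy : P (Y ⁻¹' {y}) ≠ 0) (hF : ∀ j, Continuous (classCDF P X Y y j))
    (hc : IsCopulaDensity P X Y y c) (hcc : ContinuousOn c (cube d)) :
    ∫ u in cube d, c u = 1 := by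
  have : IsProbabilityMeasure (cond P (Y ⁻¹' {y})) := cond_isProbabilityMeasure hy
  have hU : Measurable fun ω (j : Fin d) => classCDF P X Y y j (X ω j) :=
    measurable_pi_lambda _ fun j => (hF j).measurable.comp ((measurable_pi_apply j).comp hX)
  have h := congrArg (fun m => m univ) hc.2
  rw [Measure.map_apply hU MeasurableSet.univ, preimage_univ, measure_univ,
    withDensity_apply _ MeasurableSet.univ, Measure.restrict_univ,
    ← ofReal_integral_eq_lintegral_ofReal (hcc.integrableOn_compact (isCompact_cube d))] at h
  · exact (ENNReal.ofReal_eq_one.1 h.symm)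
  · filter_upwards [ae_restrict_mem (measurableSet_cube d)] with u hu using hc.1 u hu

omit hX hY hindep hident hy hF hc in
/-- The univariate marginals of a continuous copula density are uniform. -/
lemma marginal_eq_one_of_isCopulaDensity {X : Ω → Fin d → ℝ} {Y : Ω → Fin K} (hX : Measurable X)
    (hy : P (Y ⁻¹' {y}) ≠ 0) (hF : ∀ j, Continuous (classCDF P X Y y j))
    (hc : IsCopulaDensity P X Y y c) (hcc : Continuous c) (i : Fin d) :
    ∀ᵐ t ∂(volume.restrict (Icc (0 : ℝ) 1)), marginal c i t = 1 := by
  have : IsProbabilityMeasure (cond P (Y ⁻¹' {y})) := cond_isProbabilityMeasure hy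
  have hU : Measurable fun ω (j : Fin d) => classCDF P X Y y j (X ω j) :=
    measurable_pi_lambda _ fun j => (hF j).measurable.comp ((measurable_pi_apply j).comp hX)
  have hXi : Measurable fun ω => X ω i := (measurable_pi_apply i).comp hX
  have : IsProbabilityMeasure ((cond P (Y ⁻¹' {y})).map fun ω => X ω i) :=
    Measure.isProbabilityMeasure_map hXi.aemeasurable
  refine marginal_eq_one_of_map_eval i hcc hc.1 ?_
  rw [← hc.2, Measure.map_map (measurable_pi_apply i) hU,
    ← map_cdf_eq_restrict_volume (μ := (cond P (Y ⁻¹' {y})).map fun ω => X ω i) (hF i),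
    Measure.map_map (monotone_cdf _).measurable hXi]
  rfl

omit hX hY hindep hident hy hF hc [IsProbabilityMeasure P] in
/-- Replacing a density on the cube by its continuous extension. -/
lemma IsCopulaDensity.congr {X : Ω → Fin d → ℝ} {Y : Ω → Fin K} {g : (Fin d → ℝ) → ℝ}
    (hc : IsCopulaDensity P X Y y c) (hcg : EqOn c g (cube d)) : IsCopulaDensity P X Y y g := by
  refine ⟨fun u hu => hcg hu ▸ hc.1 u hu, hc.2.trans (withDensity_congr_ae ?_)⟩
  filter_upwards [ae_restrict_mem (measurableSet_cube d)] with u hu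
  rw [hcg hu]

end likelihood

/-! ### Approximation of the copula density by a normalized network -/

lemma abs_neuralDensity_sub_le {d : ℕ} {θ : ReLUNet d} {Λ : ℝ≥0}
    (hθ : LipschitzOnWith Λ θ.eval (cube d)) {c : (Fin d → ℝ) → ℝ} (hc : Continuous c)
    (hc1 : ∫ u in cube d, c u = 1) {ε : ℝ} (hε : ∀ u ∈ cube d, |positiveNet θ u - c u| ≤ ε)
    {u : Fin d → ℝ} (hu : u ∈ cube d) :
    |neuralDensity θ u - c u| ≤ (Real.exp Λ + 1) * ε := by
  set I := ∫ v in cube d, positiveNet θ v with hI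
  have hIpos : 0 < I := integral_positiveNet_pos θ
  have hI1 : |I - 1| ≤ ε := by
    rw [← hc1, hI, ← integral_sub (integrableOn_positiveNet θ)
      (hc.continuousOn.integrableOn_compact (isCompact_cube d))]
    have := norm_setIntegral_le_of_norm_le_const (μ := volume) (s := cube d)
      (f := fun v => positiveNet θ v - c v) (C := ε)
      (by rw [volume_cube]; exact ENNReal.one_lt_top) hε
    simpa [Measure.real, volume_cube] using this
  have hN : positiveNet θ u = neuralDensity θ u * I := by
    unfold neuralDensity
    rw [div_mul_cancel₀ _ hIpos.ne']
  have h1 : neuralDensity θ u - c u =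
      neuralDensity θ u * (1 - I) + (positiveNet θ u - c u) := by rw [hN]; ring
  rw [h1]
  refine (abs_add_le _ _).trans ?_
  rw [abs_mul, abs_of_pos (neuralDensity_pos θ u), abs_sub_comm 1 I, add_mul, one_mul]
  exact add_le_add (mul_le_mul (neuralDensity_le_exp hθ hu) hI1 (abs_nonneg _)
    (Real.exp_pos _).le) (hε u hu)

/-- The density is at most slightly larger than a uniformly close normalized network. -/
lemma le_one_add_mul_neuralDensity {d : ℕ} {θ : ReLUNet d} {Λ : ℝ≥0}
    (hθ : LipschitzOnWith Λ θ.eval (cube d)) {c : (Fin d → ℝ) → ℝ} {a : ℝ} (ha : 0 ≤ a)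
    {u : Fin d → ℝ} (hu : u ∈ cube d) (h : |neuralDensity θ u - c u| ≤ a) :
    c u ≤ (1 + Real.exp Λ * a) * neuralDensity θ u := by
  have h1 := (abs_le.1 h).1
  have h2 : 1 ≤ Real.exp Λ * neuralDensity θ u := by
    have := mul_le_mul_of_nonneg_left (exp_neg_le_neuralDensity hθ hu) (Real.exp_pos Λ).le
    rwa [← Real.exp_add, add_neg_cancel, Real.exp_zero] at this
  nlinarith

/-! ### Entropy of the network classes -/

lemma eventually_rpow_mul_log_rpow_le {β τ ε : ℝ} (h : β < τ) (b : ℝ) (hε : 0 < ε) :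
    ∀ᶠ n : ℕ in atTop, (n : ℝ) ^ β * Real.log n ^ b ≤ ε * (n : ℝ) ^ τ := by
  have h1 := (isLittleO_log_rpow_rpow_atTop b (sub_pos.2 h)).bound hε
  filter_upwards [tendsto_natCast_atTop_atTop.eventually h1, eventually_gt_atTop 0] with n hn hpos
  have hn0 : (0 : ℝ) < n := by exact_mod_cast hpos
  calc (n : ℝ) ^ β * Real.log n ^ b ≤ (n : ℝ) ^ β * (ε * (n : ℝ) ^ (τ - β)) := by
        gcongr
        refine (le_abs_self _).trans ?_
        have hnn : 0 ≤ (n : ℝ) ^ (τ - β) := by positivity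
        simpa [Real.norm_eq_abs, abs_of_nonneg hnn] using hn
    _ = ε * ((n : ℝ) ^ β * (n : ℝ) ^ (τ - β)) := by ring
    _ = _ := by rw [← Real.rpow_add hn0]; congr 2; ring

lemma tendsto_natCast_rpow_atTop {τ : ℝ} (hτ : 0 < τ) :
    Tendsto (fun n : ℕ => (n : ℝ) ^ τ) atTop atTop :=
  (tendsto_rpow_atTop hτ).comp tendsto_natCast_atTop_atTop

/-- The logarithm of the cardinality of the uniform net. -/
lemma card_le_exp {L S w q N : ℕ} (hw : 1 ≤ w) (hq : 1 ≤ q)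
    (hN : N ≤ (S + 2) ^ L * (5 * q * w) ^ S) :
    (N : ℝ) ≤ Real.exp (L * Real.log (S + 2) +
      S * (Real.log 5 + Real.log q + Real.log w)) := by
  have hw' : (0 : ℝ) < w := by exact_mod_cast hw
  have hq' : (0 : ℝ) < q := by exact_mod_cast hq
  have h : (N : ℝ) ≤ ((S : ℝ) + 2) ^ L * (5 * q * w) ^ S := by exact_mod_cast hN
  refine h.trans (le_of_eq ?_)
  rw [← Real.log_mul (by norm_num) hq'.ne', ← Real.log_mul (by positivity) hw'.ne', Real.exp_add,
    ← Real.log_pow, ← Real.log_pow, Real.exp_log (by positivity), Real.exp_log (by positivity)]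

lemma log_resolution_le {n p L : ℕ} {C ℓ : ℝ} (hn : 0 < n) (hℓ : ℓ = Real.log n) (hℓ1 : 1 ≤ ℓ)
    (hC : 0 ≤ C) (hL : (L : ℝ) ≤ C * ℓ) :
    Real.log 5 + Real.log (n * (L + 1) * (2 * ((n ^ p : ℕ) : ℝ) ^ 2) ^ (L + 1)) +
      Real.log ((n ^ p : ℕ) : ℝ) ≤ (6 + 2 * C + 2 * p * C + 3 * p) * ℓ ^ 2 := by
  have hn' : (0 : ℝ) < n := by exact_mod_cast hn
  have hL0 : (0 : ℝ) ≤ L := Nat.cast_nonneg _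
  have hp0 : (0 : ℝ) ≤ p := Nat.cast_nonneg _
  have h5 : Real.log 5 ≤ 4 := by
    have := Real.log_le_sub_one_of_pos (show (0 : ℝ) < 5 by norm_num)
    linarith
  have h2 : Real.log 2 ≤ 1 := by
    have := Real.log_le_sub_one_of_pos (show (0 : ℝ) < 2 by norm_num)
    linarith
  have hL1 : Real.log (L + 1) ≤ L := by
    have := Real.log_le_sub_one_of_pos (show (0 : ℝ) < L + 1 by linarith)
    linarith
  have e1 : Real.log ((n ^ p : ℕ) : ℝ) = p * ℓ := by
    push_cast
    rw [Real.log_pow, hℓ]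
  have e2 : Real.log (n * (L + 1) * (2 * ((n ^ p : ℕ) : ℝ) ^ 2) ^ (L + 1)) =
      ℓ + Real.log (L + 1) + (L + 1) * (Real.log 2 + 2 * (p * ℓ)) := by
    have hw : (0 : ℝ) < ((n ^ p : ℕ) : ℝ) := by exact_mod_cast Nat.pow_pos hn
    rw [Real.log_mul (by positivity) (by positivity), Real.log_mul hn'.ne' (by positivity),
      Real.log_pow, Real.log_mul (by norm_num) (by positivity), Real.log_pow, e1, ← hℓ]
    push_cast
    ring
  rw [e1, e2]
  have h6 : ((L : ℝ) + 1) * (Real.log 2 + 2 * (p * ℓ)) ≤ (C * ℓ + 1) * (1 + 2 * (p * ℓ)) := by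
    gcongr
  have hCl : 0 ≤ C * ℓ := by positivity
  have hpl : 0 ≤ p * ℓ := by positivity
  have h7 : ℓ ≤ ℓ ^ 2 := by nlinarith
  have h8 : C * ℓ ≤ C * ℓ ^ 2 := by gcongr
  have h9 : p * ℓ ≤ p * ℓ ^ 2 := by gcongr
  nlinarith

/-- Networks of logarithmic depth, polynomially bounded parameters, and size `n^β` up to logarithms
admit uniform nets at resolution `1/n` of cardinality `exp (o(n^τ))`, for every `τ > β`. -/
lemma exists_nets {d : ℕ} {L S : ℕ → ℕ} {B : ℕ → ℝ} {β τ a C : ℝ} (hτ : 0 < τ) (hβτ : β < τ)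
    (hτ1 : τ ≤ 1)
    (hL : ∃ C : ℝ, ∀ᶠ n : ℕ in atTop, (L n : ℝ) ≤ C * Real.log n)
    (hC : 0 < C)
    (hS : ∀ᶠ n : ℕ in atTop, (S n : ℝ) ≤ C * (n : ℝ) ^ β * Real.log n ^ a)
    (hB : ∃ κ : ℝ, ∀ᶠ n : ℕ in atTop, B n ≤ (n : ℝ) ^ κ) (Λ : ℝ≥0) :
    ∃ G : ℕ → Finset (ReLUNet d),
      (∀ᶠ n : ℕ in atTop, ∀ θ ∈ sieve d (L n) (S n) (B n) Λ, ∃ θ' ∈ G n, ∀ x ∈ cube d,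
        |θ.eval x - θ'.eval x| ≤ 1 / n) ∧
      Tendsto (fun n : ℕ => ((G n).card : ℝ) * Real.exp (-(n : ℝ) ^ τ)) atTop (𝓝 0) := by
  obtain ⟨C₀, hL⟩ := hL
  obtain ⟨κ, hB⟩ := hB
  set C₁ := max C₀ 0
  have hC₁ : 0 ≤ C₁ := le_max_right _ _
  obtain ⟨p, hp2, hpκ⟩ : ∃ p : ℕ, 2 ≤ p ∧ κ ≤ p := by
    obtain ⟨p, hp⟩ := exists_nat_ge κ
    exact ⟨max p 2, le_max_right _ _, hp.trans (by exact_mod_cast le_max_left _ _)⟩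
  set w : ℕ → ℕ := fun n => n ^ p with hwdef
  set q : ℕ → ℕ := fun n => n * (L n + 1) * (2 * (w n) ^ 2) ^ (L n + 1) with hqdef
  have hlog1 : ∀ᶠ n : ℕ in atTop, 1 ≤ Real.log n :=
    (Real.tendsto_log_atTop.comp tendsto_natCast_atTop_atTop).eventually (eventually_ge_atTop 1)
  have hSn : ∀ᶠ n : ℕ in atTop, S n + 2 ≤ w n := by
    filter_upwards [hS, eventually_rpow_mul_log_rpow_le hβτ a (inv_pos.2 hC),
      eventually_ge_atTop 2] with n h1 h2 h3
    have hn1 : (1 : ℝ) ≤ n := by exact_mod_cast (by omega : 1 ≤ n)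
    have h4 : (S n : ℝ) ≤ n := by
      calc (S n : ℝ) ≤ C * ((n : ℝ) ^ β * Real.log n ^ a) := by rw [← mul_assoc]; exact h1
        _ ≤ C * (C⁻¹ * (n : ℝ) ^ τ) := by gcongr
        _ = (n : ℝ) ^ τ := by rw [← mul_assoc, mul_inv_cancel₀ hC.ne', one_mul]
        _ ≤ (n : ℝ) ^ (1 : ℝ) := Real.rpow_le_rpow_of_exponent_le hn1 hτ1
        _ = n := Real.rpow_one _
    have h5 : S n ≤ n := by exact_mod_cast h4
    calc S n + 2 ≤ n ^ 2 := by nlinarith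
      _ ≤ n ^ p := Nat.pow_le_pow_right (by omega) hp2
  have hnet : ∀ n : ℕ, ∃ G : Finset (ReLUNet d), 0 < n → S n ≤ w n →
      G.card ≤ (S n + 2) ^ (L n) * (5 * q n * w n) ^ (S n) ∧
      ∀ θ : ReLUNet d, θ.depth ≤ L n → θ.size ≤ S n → θ.ParamsBoundedBy (w n) → ∃ θ' ∈ G,
        ∀ x ∈ cube d, |θ.eval x - θ'.eval x| ≤
          (2 * (w n : ℝ) ^ 2) ^ (L n + 1) * (L n + 1) / q n := by
    intro n
    by_cases h : 0 < n ∧ S n ≤ w n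
    · have hw : 1 ≤ w n := Nat.pow_pos h.1
      have hq : 1 ≤ q n := Nat.mul_pos (Nat.mul_pos h.1 (Nat.succ_pos _))
        (Nat.pow_pos (Nat.mul_pos two_pos (Nat.pow_pos hw)))
      obtain ⟨G, h1, h2⟩ := ReLUNet.exists_finset_approx d (L n) (S n) (w n) (q n) h.2 hw hq
      exact ⟨G, fun _ _ => ⟨h1, h2⟩⟩
    · exact ⟨∅, fun h1 h2 => absurd ⟨h1, h2⟩ h⟩
  choose G hG using hnet
  refine ⟨G, ?_, ?_⟩
  · filter_upwards [hSn, hB, eventually_gt_atTop 0] with n h1 h2 h3 θ hθ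
    obtain ⟨hd, hs, hp, -⟩ := hθ
    have hn1 : (1 : ℝ) ≤ n := by exact_mod_cast h3
    have hBw : B n ≤ (w n : ℝ) := by
      refine h2.trans ((Real.rpow_le_rpow_of_exponent_le hn1 hpκ).trans (le_of_eq ?_))
      rw [Real.rpow_natCast, hwdef]
      push_cast
      rfl
    obtain ⟨θ', hθ', h4⟩ := (hG n h3 (by omega)).2 θ hd hs (hp.mono hBw)
    refine ⟨θ', hθ', fun x hx => (h4 x hx).trans (le_of_eq ?_)⟩
    have hw : (0 : ℝ) < w n := by exact_mod_cast Nat.pow_pos h3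
    rw [hqdef]
    push_cast
    field_simp
  · have hlim : Tendsto (fun n : ℕ => Real.exp (-(1 / 2 * (n : ℝ) ^ τ))) atTop (𝓝 0) :=
      Real.tendsto_exp_neg_atTop_nhds_zero.comp
        ((tendsto_natCast_rpow_atTop hτ).const_mul_atTop (by norm_num))
    set D := 6 + 2 * C₁ + 2 * p * C₁ + 3 * p with hD
    have hDpos : 0 < D := by positivity
    refine squeeze_zero' (Eventually.of_forall fun n => by positivity) ?_ hlim
    filter_upwards [hSn, hL, hS, hlog1, eventually_gt_atTop 0,
      eventually_rpow_mul_log_rpow_le hτ 2 (show 0 < 1 / (4 * (C₁ * p + 1)) by positivity),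
      eventually_rpow_mul_log_rpow_le hβτ (a + 2) (show 0 < 1 / (4 * (C * D)) by positivity)]
      with n h1 h2 h3 h4 h5 h6 h7
    have hn' : (0 : ℝ) < n := by exact_mod_cast h5
    have hw : 1 ≤ w n := Nat.pow_pos h5
    have hq : 1 ≤ q n := Nat.mul_pos (Nat.mul_pos h5 (Nat.succ_pos _))
      (Nat.pow_pos (Nat.mul_pos two_pos (Nat.pow_pos hw)))
    set ℓ := Real.log n with hℓ
    have hℓ0 : 0 < ℓ := by linarith
    have hL' : (L n : ℝ) ≤ C₁ * ℓ := h2.trans (by gcongr; exact le_max_left _ _)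
    have hres := log_resolution_le (p := p) (L := L n) h5 hℓ h4 hC₁ hL'
    have hcard := card_le_exp hw hq (hG n h5 (by omega)).1
    have hlogS : Real.log ((S n : ℝ) + 2) ≤ p * ℓ := by
      have : Real.log ((S n : ℝ) + 2) ≤ Real.log ((n : ℝ) ^ p) :=
        Real.log_le_log (by positivity) (by exact_mod_cast h1)
      rwa [Real.log_pow] at this
    have e1 : (L n : ℝ) * Real.log ((S n : ℝ) + 2) ≤ 1 / 4 * (n : ℝ) ^ τ := by
      have h6' : ℓ ^ 2 ≤ 1 / (4 * (C₁ * p + 1)) * (n : ℝ) ^ τ := by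
        rw [Real.rpow_zero, one_mul, Real.rpow_two] at h6
        exact h6
      calc (L n : ℝ) * Real.log ((S n : ℝ) + 2) ≤ (C₁ * ℓ) * (p * ℓ) := by
            refine mul_le_mul hL' hlogS (Real.log_nonneg ?_) (by positivity)
            have : (0 : ℝ) ≤ S n := Nat.cast_nonneg _
            linarith
        _ ≤ (C₁ * p + 1) * ℓ ^ 2 := by nlinarith [sq_nonneg ℓ]
        _ ≤ (C₁ * p + 1) * (1 / (4 * (C₁ * p + 1)) * (n : ℝ) ^ τ) := by gcongr
        _ = _ := by
          have : C₁ * p + 1 ≠ 0 := by positivity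
          field_simp
    have e2 : (S n : ℝ) * (Real.log 5 + Real.log (q n) + Real.log (w n)) ≤
        1 / 4 * (n : ℝ) ^ τ := by
      have hres' : Real.log 5 + Real.log (q n) + Real.log (w n) ≤ D * ℓ ^ 2 := by
        refine le_trans (le_of_eq ?_) hres
        rw [hqdef, hwdef]
        push_cast
        rfl
      calc (S n : ℝ) * (Real.log 5 + Real.log (q n) + Real.log (w n))
          ≤ (C * (n : ℝ) ^ β * ℓ ^ a) * (D * ℓ ^ 2) := by
            refine mul_le_mul h3 hres' ?_ (by positivity)
            have := Real.log_nonneg (show (1 : ℝ) ≤ 5 by norm_num)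
            have := Real.log_natCast_nonneg (q n)
            have := Real.log_natCast_nonneg (w n)
            positivity
        _ = C * D * ((n : ℝ) ^ β * ℓ ^ (a + 2)) := by
            rw [Real.rpow_add hℓ0, Real.rpow_two]; ring
        _ ≤ C * D * (1 / (4 * (C * D)) * (n : ℝ) ^ τ) := by gcongr
        _ = _ := by
          field_simp
    calc ((G n).card : ℝ) * Real.exp (-(n : ℝ) ^ τ)
        ≤ Real.exp (1 / 4 * (n : ℝ) ^ τ + 1 / 4 * (n : ℝ) ^ τ) * Real.exp (-(n : ℝ) ^ τ) := by
          gcongr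
          exact hcard.trans (Real.exp_le_exp.2 (add_le_add e1 e2))
      _ = _ := by rw [← Real.exp_add]; congr 1; ring

/-! ### The basic inequality -/

section basic

variable {Ω : Type*} [MeasurableSpace Ω] {d K : ℕ} {X : ℕ → Ω → Fin d → ℝ} {Y : ℕ → Ω → Fin K}
  {y : Fin K}

omit [MeasurableSpace Ω] in
/-- A maximizer has a small defect when the reference network does and when the pseudo-observations
and the log-likelihood ratios at the points `U i` are under control. -/
lemma mul_marginalDefect_le {Fhat : ℕ → Ω → Fin d → ℝ → ℝ} {lam : ℕ → ℝ} {n : ℕ} {ω : Ω}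
    {L S : ℕ} {B : ℝ} {Λ : ℝ≥0} {θ θ₀ θ' : ReLUNet d} (hθ : θ ∈ sieve d L S B Λ)
    (hmax : IsMaxOn (penalizedObjective X Y y Fhat lam n ω) (sieve d L S B Λ) θ)
    (hθ₀ : θ₀ ∈ sieve d L S B Λ) {e η s : ℝ} (hclose : ∀ u ∈ cube d, |θ.eval u - θ'.eval u| ≤ e)
    {U : ℕ → Fin d → ℝ} (hU : ∀ i, U i ∈ cube d) (hη0 : 0 ≤ η)
    (hFhat : ∀ j x, Fhat n ω j x ∈ Icc (0 : ℝ) 1)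
    (hη : ∀ i j, |Fhat n ω j (X i ω j) - U i j| ≤ η)
    (hpos : 0 < classCount Y y n ω)
    (hs : ∑ i ∈ classIndices Y y n ω,
      (Real.log (neuralDensity θ' (U i)) - Real.log (neuralDensity θ₀ (U i))) ≤ s) :
    lam n * marginalDefect (neuralDensity θ) ≤
      lam n * marginalDefect (neuralDensity θ₀) + 2 * Λ * η + 2 * e + s / classCount Y y n ω := by
  have hQ : penalizedObjective X Y y Fhat lam n ω θ₀ ≤ penalizedObjective X Y y Fhat lam n ω θ :=
    hmax hθ₀
  set N : ℝ := (classCount Y y n ω : ℝ)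
  have hN : 0 < N := Nat.cast_pos.2 hpos
  set V : ℕ → Fin d → ℝ := fun i j => Fhat n ω j (X i ω j) with hV
  have hVc : ∀ i, V i ∈ cube d := fun i => ⟨fun j => (hFhat j _).1, fun j => (hFhat j _).2⟩
  have hdist : ∀ i, dist (V i) (U i) ≤ η := fun i =>
    (dist_pi_le_iff hη0).2 fun j => by rw [Real.dist_eq]; exact hη i j
  have hsum : ∑ i ∈ classIndices Y y n ω,
      (Real.log (neuralDensity θ (V i)) - Real.log (neuralDensity θ₀ (V i))) ≤
      s + N * (2 * Λ * η + 2 * e) := by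
    have h1 : ∀ i, Real.log (neuralDensity θ (V i)) - Real.log (neuralDensity θ₀ (V i)) ≤
        (Real.log (neuralDensity θ' (U i)) - Real.log (neuralDensity θ₀ (U i))) +
          (2 * Λ * η + 2 * e) := by
      intro i
      have a1 := log_neuralDensity_sub_le hθ.2.2.2 (hVc i) (hU i)
      have a2 := log_neuralDensity_sub_le hθ₀.2.2.2 (hU i) (hVc i)
      rw [dist_comm] at a2
      have a3 := log_neuralDensity_le hclose (hU i)
      have a4 : (Λ : ℝ) * dist (V i) (U i) ≤ Λ * η := by gcongr; exact hdist i
      linarith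
    refine (Finset.sum_le_sum fun i _ => h1 i).trans ?_
    rw [Finset.sum_add_distrib, Finset.sum_const, nsmul_eq_mul]
    exact add_le_add hs le_rfl
  have hlik : logLikelihood X Y y Fhat n ω θ - logLikelihood X Y y Fhat n ω θ₀ ≤
      s / N + (2 * Λ * η + 2 * e) := by
    unfold logLikelihood
    rw [← mul_sub, ← Finset.sum_sub_distrib, one_div, ← div_eq_inv_mul, div_le_iff₀ hN, add_mul,
      div_mul_cancel₀ _ hN.ne']
    linarith [hsum]
  unfold penalizedObjective at hQ
  linarith

/-- Deviation of the smoothed empirical distribution function from the conditional one. -/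
lemma abs_sub_classCDF_le {P : Measure Ω} {Fhat : ℕ → Ω → Fin d → ℝ → ℝ} {n : ℕ} {ω : Ω}
    {j : Fin d} {x M s : ℝ} (hpos : 0 < classCount Y y n ω)
    (hM : √(classCount Y y n ω : ℝ) * |Fhat n ω j x - empiricalCDF X Y y n ω j x| ≤ M)
    (hs : |(classCountLe X Y y n ω j x : ℝ) -
      classCDF P (X 0) (Y 0) y j x * classCount Y y n ω| ≤ s) :
    |Fhat n ω j x - classCDF P (X 0) (Y 0) y j x| ≤
      M / √(classCount Y y n ω : ℝ) + s / classCount Y y n ω := by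
  have hN : (0 : ℝ) < classCount Y y n ω := by exact_mod_cast hpos
  have hr : 0 < √(classCount Y y n ω : ℝ) := Real.sqrt_pos.2 hN
  refine (abs_sub_le _ (empiricalCDF X Y y n ω j x) _).trans (add_le_add ?_ ?_)
  · rwa [le_div_iff₀ hr, mul_comm]
  · have : empiricalCDF X Y y n ω j x - classCDF P (X 0) (Y 0) y j x =
        ((classCountLe X Y y n ω j x : ℝ) -
          classCDF P (X 0) (Y 0) y j x * classCount Y y n ω) / classCount Y y n ω := by
      rw [sub_div, mul_div_cancel_right₀ _ hN.ne']
      rfl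
    rw [this, abs_div, abs_of_pos hN]
    gcongr

end basic

/-! ### Rates -/

/-- The deterministic conclusion of the basic inequality at the rate `n^γ`, `γ ≤ 1/2`. -/
lemma rpow_mul_le_of_basic {n N γ p lam D D₀ Λ M C₂ η s : ℝ} (hn : 1 ≤ n) (hγ : γ ≤ 1 / 2)
    (hp : 0 < p) (hN : n * p ≤ N) (hlam : 0 < lam) (hΛ : 0 ≤ Λ) (hM : 0 ≤ M) (hC₂ : 0 ≤ C₂)
    (hη : η ≤ M / √N + (n * n ^ (-γ) + 1) / N) (hs : s = n * ((C₂ + 1) * n ^ (-γ)))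
    (h : lam * D ≤ lam * D₀ + 2 * Λ * η + 2 * (1 / n) + s / N) :
    n ^ γ * D ≤ n ^ γ * D₀ + (2 * Λ * (M / √p + 2 / p) + 2 + (C₂ + 1) / p) / lam := by
  have hn0 : 0 < n := by linarith
  have hNpos : 0 < N := lt_of_lt_of_le (by positivity) hN
  set g := n ^ γ with hg
  have hg0 : 0 < g := Real.rpow_pos_of_pos hn0 _
  have hgg : g * n ^ (-γ) = 1 := by rw [hg, ← Real.rpow_add hn0]; simp
  have hgs : g ≤ √n := by
    rw [Real.sqrt_eq_rpow]
    exact Real.rpow_le_rpow_of_exponent_le hn hγ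
  have hgn : g ≤ n := hgs.trans (by
    rw [Real.sqrt_le_left (by linarith)]
    nlinarith)
  have b1 : g * (M / √N) ≤ M / √p := by
    have h1 : √n * √p ≤ √N := by
      rw [← Real.sqrt_mul hn0.le]
      exact Real.sqrt_le_sqrt hN
    have hsp : 0 < √p := Real.sqrt_pos.2 hp
    rw [← mul_div_assoc, div_le_div_iff₀ (Real.sqrt_pos.2 hNpos) hsp]
    calc g * M * √p = M * (g * √p) := by ring
      _ ≤ M * (√n * √p) := by gcongr
      _ ≤ M * √N := by gcongr
  have b2 : g * ((n * n ^ (-γ) + 1) / N) ≤ 2 / p := by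
    rw [← mul_div_assoc, div_le_div_iff₀ hNpos hp]
    have h1 : g * (n * n ^ (-γ) + 1) = n + g := by
      rw [mul_add, mul_left_comm, hgg]; ring
    rw [h1]
    calc (n + g) * p ≤ (n + n) * p := by gcongr
      _ = 2 * (n * p) := by ring
      _ ≤ 2 * N := by gcongr
  have b3 : g * (2 * (1 / n)) ≤ 2 := by
    have : g / n ≤ 1 := by rw [div_le_one hn0]; exact hgn
    calc g * (2 * (1 / n)) = 2 * (g / n) := by ring
      _ ≤ 2 := by linarith
  have b4 : g * (s / N) ≤ (C₂ + 1) / p := by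
    rw [← mul_div_assoc, div_le_div_iff₀ hNpos hp, hs]
    have h1 : g * (n * ((C₂ + 1) * n ^ (-γ))) = n * (C₂ + 1) := by
      calc _ = n * (C₂ + 1) * (g * n ^ (-γ)) := by ring
        _ = _ := by rw [hgg, mul_one]
    rw [h1]
    calc n * (C₂ + 1) * p = (C₂ + 1) * (n * p) := by ring
      _ ≤ (C₂ + 1) * N := by gcongr
  have b5 : g * η ≤ M / √p + 2 / p := by
    calc g * η ≤ g * (M / √N + (n * n ^ (-γ) + 1) / N) := by gcongr
      _ ≤ _ := by rw [mul_add]; exact add_le_add b1 b2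
  have b6 : 2 * Λ * (g * η) ≤ 2 * Λ * (M / √p + 2 / p) := by gcongr
  have h2 := mul_le_mul_of_nonneg_left h hg0.le
  have h3 : lam * (g * D) ≤ lam * (g * D₀) +
      (2 * Λ * (M / √p + 2 / p) + 2 + (C₂ + 1) / p) := by
    calc lam * (g * D) = g * (lam * D) := by ring
      _ ≤ g * (lam * D₀ + 2 * Λ * η + 2 * (1 / n) + s / N) := h2
      _ = lam * (g * D₀) + (2 * Λ * (g * η) + g * (2 * (1 / n)) + g * (s / N)) := by ring
      _ ≤ _ := by linarith
  rw [← sub_le_iff_le_add', le_div_iff₀ hlam]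
  linarith

lemma one_add_mul_rpow_pow_mul_exp_le {C₂ γ : ℝ} (hC₂ : 0 ≤ C₂) {n : ℕ} (hn : 0 < n) :
    (1 + C₂ * (n : ℝ) ^ (-γ)) ^ n * Real.exp (-(n * ((C₂ + 1) * (n : ℝ) ^ (-γ)))) ≤
      Real.exp (-(n : ℝ) ^ (1 - γ)) := by
  have hn0 : (0 : ℝ) < n := by exact_mod_cast hn
  have h1 : (1 + C₂ * (n : ℝ) ^ (-γ)) ^ n ≤ Real.exp (n * (C₂ * (n : ℝ) ^ (-γ))) := by
    rw [Real.exp_nat_mul]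
    gcongr
    rw [add_comm]
    exact Real.add_one_le_exp _
  have h2 : (n : ℝ) ^ (1 - γ) = n * (n : ℝ) ^ (-γ) := by
    rw [sub_eq_add_neg, Real.rpow_add hn0, Real.rpow_one]
  calc _ ≤ Real.exp (n * (C₂ * (n : ℝ) ^ (-γ))) *
        Real.exp (-(n * ((C₂ + 1) * (n : ℝ) ^ (-γ)))) := by gcongr
    _ = _ := by rw [← Real.exp_add, h2]; congr 1; ring

lemma tendsto_mul_exp_neg_mul_rpow {γ : ℝ} (hγ : γ < 1 / 2) (b : ℝ) :
    Tendsto (fun n : ℕ => b * n * (2 * Real.exp (-(n * ((n : ℝ) ^ (-γ)) ^ 2 / 2)))) atTop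
      (𝓝 0) := by
  have hτ : 0 < 1 - 2 * γ := by linarith
  have h1 : Tendsto (fun x : ℝ => x ^ (1 / (1 - 2 * γ)) * Real.exp (-(1 / 2) * x)) atTop (𝓝 0) :=
    tendsto_rpow_mul_exp_neg_mul_atTop_nhds_zero _ _ (by norm_num)
  have h2 := (h1.comp (tendsto_natCast_rpow_atTop hτ)).const_mul (b * 2)
  rw [mul_zero] at h2
  refine h2.congr' ?_
  filter_upwards [eventually_gt_atTop 0] with n hn
  have hn0 : (0 : ℝ) < n := by exact_mod_cast hn
  have e1 : ((n : ℝ) ^ (1 - 2 * γ)) ^ (1 / (1 - 2 * γ)) = n := by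
    rw [← Real.rpow_mul hn0.le, mul_one_div_cancel hτ.ne', Real.rpow_one]
  have e2 : (n : ℝ) * ((n : ℝ) ^ (-γ)) ^ 2 = (n : ℝ) ^ (1 - 2 * γ) := by
    rw [← Real.rpow_natCast, ← Real.rpow_mul hn0.le]
    nth_rewrite 1 [← Real.rpow_one (n : ℝ)]
    rw [← Real.rpow_add hn0]
    congr 1
    push_cast
    ring
  simp only [Function.comp_apply]
  rw [e1, e2]
  ring_nf

lemma tendsto_two_mul_exp_neg_mul {b : ℝ} (hb : 0 < b) :
    Tendsto (fun n : ℕ => 2 * Real.exp (-(n * b ^ 2 / 2))) atTop (𝓝 0) := by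
  have h : Tendsto (fun n : ℕ => (n : ℝ) * (b ^ 2 / 2)) atTop atTop :=
    tendsto_natCast_atTop_atTop.atTop_mul_const (by positivity)
  have := (Real.tendsto_exp_neg_atTop_nhds_zero.comp h).const_mul 2
  rw [mul_zero] at this
  refine this.congr fun n => ?_
  simp only [Function.comp_apply, mul_div_assoc]

/-- The marginal defect of the penalized maximum likelihood estimator is of smaller order than
`n^(-r/(2r+d))`. -/
theorem tendstoInMeasure_rpow_mul_marginalDefect
    {Ω : Type*} [MeasurableSpace Ω] {P : Measure Ω} [IsProbabilityMeasure P]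
    {d K : ℕ} {X : ℕ → Ω → Fin d → ℝ} {Y : ℕ → Ω → Fin K}
    (hX : ∀ i, Measurable (X i)) (hY : ∀ i, Measurable (Y i))
    (hindep : iIndepFun (fun i ω => (X i ω, Y i ω)) P)
    (hident : ∀ i, IdentDistrib (fun ω => (X i ω, Y i ω)) (fun ω => (X 0 ω, Y 0 ω)) P P)
    {y : Fin K} (hy : P (Y 0 ⁻¹' {y}) ≠ 0)
    (hF : ∀ j, Continuous (classCDF P (X 0) (Y 0) y j))
    {r : ℝ} (hr : 0 < r)
    {c : (Fin d → ℝ) → ℝ} (hc : IsCopulaDensity P (X 0) (Y 0) y c)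
    {Lc : ℝ≥0} (hcLip : LipschitzOnWith Lc c (cube d))
    {L S : ℕ → ℕ} {B : ℕ → ℝ} {Λ : ℝ≥0}
    (hL : ∃ C : ℝ, ∀ᶠ n : ℕ in atTop, (L n : ℝ) ≤ C * Real.log n)
    (hS : ∃ a C : ℝ, 0 < C ∧ ∀ᶠ n : ℕ in atTop,
      C⁻¹ * (n : ℝ) ^ ((d : ℝ) / (2 * r + d)) * Real.log n ^ (-a) ≤ S n ∧
      (S n : ℝ) ≤ C * (n : ℝ) ^ ((d : ℝ) / (2 * r + d)) * Real.log n ^ a)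
    (hB : ∃ κ : ℝ, ∀ᶠ n : ℕ in atTop, B n ≤ (n : ℝ) ^ κ)
    (happrox : ∃ C : ℝ, ∀ᶠ n : ℕ in atTop, ∃ θ ∈ sieve d (L n) (S n) (B n) Λ,
      ∀ u ∈ cube d, |positiveNet θ u - c u| ≤ C * (n : ℝ) ^ (-(r / (2 * r + d))))
    {Fhat : ℕ → Ω → Fin d → ℝ → ℝ} (hFhat : IsSmoothedEmpiricalCDF P X Y y Fhat)
    {lam : ℕ → ℝ} (hlam : Tendsto lam atTop atTop)
    {θhat : ℕ → Ω → ReLUNet d}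
    (hmax : ∀ᶠ n : ℕ in atTop, ∀ᵐ ω ∂P,
      θhat n ω ∈ sieve d (L n) (S n) (B n) Λ ∧
      IsMaxOn (penalizedObjective X Y y Fhat lam n ω)
        (sieve d (L n) (S n) (B n) Λ) (θhat n ω)) :
    TendstoInMeasure P
      (fun (n : ℕ) ω => (n : ℝ) ^ (r / (2 * r + d)) *
        marginalDefect (neuralDensity (θhat n ω))) atTop (fun _ => 0) := by
  have hd0 : (0 : ℝ) ≤ d := Nat.cast_nonneg d
  have hden : 0 < 2 * r + d := by positivity
  set γ := r / (2 * r + d) with hγ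
  set β := (d : ℝ) / (2 * r + d) with hβ
  have hγ0 : 0 < γ := by positivity
  have hγβ : 1 - 2 * γ = β := by
    rw [hγ, hβ]
    field_simp
    ring
  have hβ0 : 0 ≤ β := by positivity
  have hγ2 : γ ≤ 1 / 2 := by linarith
  obtain ⟨g, hgLip, hcg⟩ := hcLip.extend_real
  have hgc : Continuous g := hgLip.continuous
  have hcop := hc.congr hcg
  have hint : ∫ u in cube d, g u = 1 :=
    integral_eq_one_of_isCopulaDensity (hX 0) hy hF hcop hgc.continuousOn
  have hmarg := marginal_eq_one_of_isCopulaDensity (hX 0) hy hF hcop hgc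
  obtain ⟨a, C, hC, hS⟩ := hS
  obtain ⟨G, hG, hGcard⟩ := exists_nets (d := d) (τ := 1 - γ) (by linarith)
    (show β < 1 - γ by linarith) (by linarith) hL hC (hS.mono fun n h => h.2) hB Λ
  obtain ⟨C₀, happrox⟩ := happrox
  set C₁ := (Real.exp Λ + 1) * max C₀ 0 with hC₁
  have hC₁0 : 0 ≤ C₁ := mul_nonneg (by positivity) (le_max_right _ _)
  set C₂ := Real.exp Λ * C₁ with hC₂
  have hC₂0 : 0 ≤ C₂ := by positivity
  set p := P.real (Y 0 ⁻¹' {y}) / 2 with hp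
  have hp0 : 0 < p := half_pos ((measureReal_nonneg).lt_of_ne'
    ((measureReal_ne_zero_iff (measure_ne_top _ _)).2 hy))
  have hlim₁ := ENNReal.tendsto_ofReal (tendsto_two_mul_exp_neg_mul hp0)
  have hlim₂ : Tendsto (fun n : ℕ => ENNReal.ofReal
      (d * n * (2 * Real.exp (-(n * ((n : ℝ) ^ (-γ)) ^ 2 / 2))))) atTop
      (𝓝 (ENNReal.ofReal 0)) := by
    rcases Nat.eq_zero_or_pos d with h0 | h0
    · have : (d : ℝ) = 0 := by exact_mod_cast h0
      simp [this]
    · have hβpos : 0 < β := div_pos (by exact_mod_cast h0) hden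
      exact ENNReal.tendsto_ofReal (tendsto_mul_exp_neg_mul_rpow (by linarith) _)
  have hlim₃ := ENNReal.tendsto_ofReal hGcard
  have hlim := (hlim₁.add hlim₂).add hlim₃
  simp only [ENNReal.ofReal_zero, add_zero] at hlim
  rw [tendstoInMeasure_iff_norm]
  intro ε hε
  rw [ENNReal.tendsto_nhds_zero]
  intro η hη
  rcases eq_or_ne η ⊤ with rfl | hηtop
  · exact Eventually.of_forall fun _ => le_top
  have hη2 : 0 < η / 2 := ENNReal.half_pos hη.ne'
  have hη2top : η / 2 ≠ ⊤ := (ENNReal.div_lt_top hηtop two_ne_zero).ne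
  obtain ⟨M₀, hM₀⟩ := hFhat.2 (η / 2).toReal (ENNReal.toReal_pos hη2.ne' hη2top)
  rw [ENNReal.ofReal_toReal hη2top] at hM₀
  set M := max M₀ 0
  set R := 2 * Λ * (M / √p + 2 / p) + 2 + (C₂ + 1) / p with hR
  have hdet : Tendsto (fun n : ℕ => d * C₁ ^ 2 * (n : ℝ) ^ (-γ) + R / lam n) atTop (𝓝 0) := by
    have h1 : Tendsto (fun n : ℕ => (n : ℝ) ^ (-γ)) atTop (𝓝 0) :=
      (tendsto_rpow_neg_atTop hγ0).comp tendsto_natCast_atTop_atTop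
    simpa using (h1.const_mul (d * C₁ ^ 2)).add (hlam.const_div_atTop R)
  filter_upwards [hmax, happrox, hG, hM₀, ENNReal.tendsto_nhds_zero.1 hlim _ hη2,
    hdet.eventually (gt_mem_nhds hε), hlam.eventually (eventually_gt_atTop 0),
    eventually_gt_atTop 0] with n hmax happrox hG hM₀ hlim hdet hlam hn
  have hn1 : (1 : ℝ) ≤ n := by exact_mod_cast hn
  have hn0 : (0 : ℝ) < n := by linarith
  set δ := (n : ℝ) ^ (-γ) with hδ
  have hδ0 : 0 < δ := Real.rpow_pos_of_pos hn0 _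
  obtain ⟨θ₀, hθ₀, happ⟩ := happrox
  have hclose : ∀ u ∈ cube d, |neuralDensity θ₀ u - g u| ≤ C₁ * δ := by
    intro u hu
    refine (abs_neuralDensity_sub_le hθ₀.2.2.2 hgc hint (ε := max C₀ 0 * δ) (fun v hv => ?_)
      hu).trans (le_of_eq ?_)
    · rw [← hcg hv]
      refine (happ v hv).trans ?_
      gcongr
      exact le_max_left _ _
    · rw [hC₁]; ring
  have hcA : ∀ u ∈ cube d, g u ≤ (1 + C₂ * δ) * neuralDensity θ₀ u := by
    intro u hu
    have := le_one_add_mul_neuralDensity hθ₀.2.2.2 (by positivity) hu (hclose u hu)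
    rwa [← mul_assoc] at this
  have hD₀ : marginalDefect (neuralDensity θ₀) ≤ d * (C₁ * δ) ^ 2 :=
    marginalDefect_le hgc (continuous_neuralDensity θ₀) hclose hmarg
  set U : ℕ → Ω → Fin d → ℝ := fun i ω j => classCDF P (X 0) (Y 0) y j (X i ω j) with hU
  set s := n * ((C₂ + 1) * δ) with hs
  set E₁ := {ω | (classCount Y y n ω : ℝ) ≤ n * p}
  set E₂ := {ω | ∃ j x, n * δ + 1 < |(classCountLe X Y y n ω j x : ℝ) -
    classCDF P (X 0) (Y 0) y j x * classCount Y y n ω|}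
  set E₃ := {ω | ∃ θ ∈ G n, s ≤ ∑ i ∈ classIndices Y y n ω,
    (Real.log (neuralDensity θ (U i ω)) - Real.log (neuralDensity θ₀ (U i ω)))}
  set E₄ := {ω | ∃ j x, M₀ < √(classCount Y y n ω : ℝ) *
    |Fhat n ω j x - empiricalCDF X Y y n ω j x|}
  set E₅ := {ω | ¬ (θhat n ω ∈ sieve d (L n) (S n) (B n) Λ ∧
    IsMaxOn (penalizedObjective X Y y Fhat lam n ω) (sieve d (L n) (S n) (B n) Λ) (θhat n ω))}
  have hE₁ : P E₁ ≤ _ := measure_classCount_le hX hY hindep hident n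
  have hE₂ : P E₂ ≤ _ :=
    measure_exists_lt_abs_classCountLe_sub_le hX hY hindep hident hy hF hn hδ0.le
  have hE₃ : P E₃ ≤ ENNReal.ofReal ((G n).card * Real.exp (-(n : ℝ) ^ (1 - γ))) := by
    refine (measure_exists_le_sum_log_ratio_le hX hY hindep hident hy hF hcop (G n) θ₀
      (A := 1 + C₂ * δ) (by linarith [mul_nonneg hC₂0 hδ0.le]) hcA n s).trans ?_
    refine ENNReal.ofReal_le_ofReal (mul_le_mul_of_nonneg_left ?_ (Nat.cast_nonneg _))
    exact one_add_mul_rpow_pow_mul_exp_le hC₂0 hn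
  have hE₅ : P E₅ = 0 := hmax
  have hsub : {ω | ε ≤ ‖(n : ℝ) ^ γ * marginalDefect (neuralDensity (θhat n ω)) - 0‖} ⊆
      ((E₁ ∪ E₂) ∪ E₃) ∪ (E₄ ∪ E₅) := by
    intro ω hω
    by_contra hcon
    simp only [mem_union, not_or] at hcon
    obtain ⟨⟨⟨h₁, h₂⟩, h₃⟩, h₄, h₅⟩ := hcon
    obtain ⟨hmem, hmax⟩ := not_not.1 h₅
    simp only [E₁, E₂, E₃, E₄, mem_ofPred_eq, not_le, not_exists, not_lt, not_and] at h₁ h₂ h₃ h₄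
    have hpos : 0 < classCount Y y n ω := by
      have : (0 : ℝ) < classCount Y y n ω := lt_trans (by positivity) h₁
      exact_mod_cast this
    obtain ⟨θ', hθ', hclose'⟩ := hG _ hmem
    have hM0 : 0 ≤ M := le_max_right _ _
    set e := M / √(classCount Y y n ω : ℝ) + (n * δ + 1) / classCount Y y n ω with he
    have hbasic := mul_marginalDefect_le hmem hmax hθ₀ hclose' (U := fun i => U i ω)
      (fun i => classCDF_mem_cube _ _ _ _) (η := e) (by positivity) (hFhat.1 n ω)
      (fun i j => abs_sub_classCDF_le hpos ((h₄ j _).trans (le_max_left _ _)) (h₂ j _)) hpos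
      (h₃ θ' hθ').le
    have hfin := rpow_mul_le_of_basic hn1 hγ2 hp0 h₁.le hlam Λ.coe_nonneg hM0 hC₂0 he.le hs hbasic
    rw [← hR] at hfin
    have hmain : (n : ℝ) ^ γ * marginalDefect (neuralDensity θ₀) ≤ d * C₁ ^ 2 * δ := by
      calc _ ≤ (n : ℝ) ^ γ * (d * (C₁ * δ) ^ 2) := by gcongr
        _ = d * C₁ ^ 2 * δ * ((n : ℝ) ^ γ * δ) := by ring
        _ = _ := by rw [hδ, ← Real.rpow_add hn0, add_neg_cancel, Real.rpow_zero, mul_one]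
    have hD := marginalDefect_nonneg (neuralDensity (θhat n ω))
    simp only [mem_ofPred_eq, sub_zero, Real.norm_eq_abs] at hω
    rw [abs_of_nonneg (by positivity)] at hω
    linarith
  calc P {ω | ε ≤ ‖(n : ℝ) ^ γ * marginalDefect (neuralDensity (θhat n ω)) - 0‖}
      ≤ (P E₁ + P E₂ + P E₃) + (P E₄ + P E₅) :=
        (measure_mono hsub).trans ((measure_union_le _ _).trans (add_le_add
          ((measure_union_le _ _).trans (add_le_add (measure_union_le _ _) le_rfl))
          (measure_union_le _ _)))
    _ ≤ η / 2 + (η / 2 + 0) := by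
        refine add_le_add ((add_le_add (add_le_add hE₁ hE₂) hE₃).trans hlim) ?_
        exact add_le_add hM₀ hE₅.le
    _ = η := by rw [add_zero, ENNReal.add_halves]

end DeepCopula

theorem proposition1
    {Ω : Type*} [MeasurableSpace Ω] (P : Measure Ω) [IsProbabilityMeasure P]
    {d K : ℕ}
    -- i.i.d. labelled sample
    (X : ℕ → Ω → Fin d → ℝ) (Y : ℕ → Ω → Fin K)
    (hX : ∀ i, Measurable (X i)) (hY : ∀ i, Measurable (Y i))
    (hindep : iIndepFun (fun i ω => (X i ω, Y i ω)) P)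
    (hident : ∀ i, IdentDistrib (fun ω => (X i ω, Y i ω)) (fun ω => (X 0 ω, Y 0 ω)) P P)
    -- the class
    (y : Fin K) (hy : P (Y 0 ⁻¹' {y}) ≠ 0)
    -- marginal regularity
    (hF : ∀ j, Continuous (DeepCopula.classCDF P (X 0) (Y 0) y j))
    -- the true copula density
    (r : ℝ) (hr : (d : ℝ) / 2 < r)
    (c : (Fin d → ℝ) → ℝ) (hc : DeepCopula.IsCopulaDensity P (X 0) (Y 0) y c)
    (hcSob : DeepCopula.MemSobolevCube r c)
    (Lc : ℝ≥0) (hcLip : LipschitzOnWith Lc c (DeepCopula.cube d))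
    -- the growing network classes
    (L S : ℕ → ℕ) (B : ℕ → ℝ) (Λ : ℝ≥0)
    (hL : ∃ C : ℝ, ∀ᶠ n : ℕ in atTop, (L n : ℝ) ≤ C * Real.log n)
    (hS : ∃ a C : ℝ, 0 < C ∧ ∀ᶠ n : ℕ in atTop,
      C⁻¹ * (n : ℝ) ^ ((d : ℝ) / (2 * r + d)) * Real.log n ^ (-a) ≤ S n ∧
      (S n : ℝ) ≤ C * (n : ℝ) ^ ((d : ℝ) / (2 * r + d)) * Real.log n ^ a)
    (hB : ∃ κ : ℝ, ∀ᶠ n : ℕ in atTop, B n ≤ (n : ℝ) ^ κ)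
    -- approximation capacity
    (happrox : ∃ C : ℝ, ∀ᶠ n : ℕ in atTop, ∃ θ ∈ DeepCopula.sieve d (L n) (S n) (B n) Λ,
      ∀ u ∈ DeepCopula.cube d,
        |DeepCopula.positiveNet θ u - c u| ≤ C * (n : ℝ) ^ (-(r / (2 * r + d))))
    -- estimated marginals, penalty weight, and maximizers of the penalized objective
    (Fhat : ℕ → Ω → Fin d → ℝ → ℝ) (hFhat : DeepCopula.IsSmoothedEmpiricalCDF P X Y y Fhat)
    (lam : ℕ → ℝ) (hlam : Tendsto lam atTop atTop)
    (θhat : ℕ → Ω → DeepCopula.ReLUNet d)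
    (hmax : ∀ᶠ n : ℕ in atTop, ∀ᵐ ω ∂P,
      θhat n ω ∈ DeepCopula.sieve d (L n) (S n) (B n) Λ ∧
      IsMaxOn (DeepCopula.penalizedObjective X Y y Fhat lam n ω)
        (DeepCopula.sieve d (L n) (S n) (B n) Λ) (θhat n ω)) :
    -- the fitted function is a probability density on the cube
    (∀ n ω, (∀ u ∈ DeepCopula.cube d, 0 < DeepCopula.neuralDensity (θhat n ω) u) ∧
      ∫ u in DeepCopula.cube d, DeepCopula.neuralDensity (θhat n ω) u = 1) ∧
    -- its marginal defect tends to zero in probability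
    TendstoInMeasure P
      (fun n ω => DeepCopula.marginalDefect (DeepCopula.neuralDensity (θhat n ω)))
      atTop (fun _ => 0) ∧
    -- and is of smaller order than the statistical rate, in probability
    TendstoInMeasure P
      (fun (n : ℕ) ω => (n : ℝ) ^ (r / (2 * r + d)) *
        DeepCopula.marginalDefect (DeepCopula.neuralDensity (θhat n ω)))
      atTop (fun _ => 0) := by
  have hr0 : 0 < r := lt_of_le_of_lt (by positivity) hr
  have hden : 0 < 2 * r + d := by positivity
  set γ := r / (2 * r + d) with hγ
  have hγ0 : 0 < γ := by positivity
  have hγ2 : γ ≤ 1 / 2 := by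
    rw [hγ, div_le_div_iff₀ hden two_pos]
    linarith [show (0 : ℝ) ≤ d from Nat.cast_nonneg d]
  have hrate : TendstoInMeasure P (fun (n : ℕ) ω => (n : ℝ) ^ γ *
      DeepCopula.marginalDefect (DeepCopula.neuralDensity (θhat n ω))) atTop (fun _ => 0) :=
    DeepCopula.tendstoInMeasure_rpow_mul_marginalDefect hX hY hindep hident hy hF hr0 hc hcLip hL
      hS hB happrox hFhat hlam hmax
  refine ⟨fun n ω => ⟨fun u _ => DeepCopula.neuralDensity_pos _ u,
    DeepCopula.integral_neuralDensity _⟩, ?_, hrate⟩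
  intro ε hε
  refine tendsto_of_tendsto_of_tendsto_of_le_of_le' tendsto_const_nhds (hrate ε hε)
    (Eventually.of_forall fun _ => zero_le) ?_
  filter_upwards [eventually_ge_atTop 1] with n hn
  refine measure_mono fun ω hω => le_trans (mem_ofPred_eq ▸ hω) ?_
  have hn1 : (1 : ℝ) ≤ (n : ℝ) ^ γ :=
    Real.one_le_rpow (by exact_mod_cast hn) hγ0.le
  have hD := DeepCopula.marginalDefect_nonneg (DeepCopula.neuralDensity (θhat n ω))
  rw [edist_dist, edist_dist, Real.dist_eq, Real.dist_eq, sub_zero, sub_zero,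
    abs_of_nonneg hD, abs_of_nonneg (mul_nonneg (zero_le_one.trans hn1) hD)]
  exact ENNReal.ofReal_le_ofReal (le_mul_of_one_le_left hD hn1)
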